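/- Let $f:[0,\infty)\to\mathbb R^{p\times m}$ be square integrable (the impulse response of the system $Z(t)=\int_{-\infty}^t f(t-\tau)\,dW(\tau)$ driven by a standard Wiener process $W$ in $\mathbb R^m$), let $\widehat F(\omega)=\int_0^\infty e^{-i\omega t}f(t)\,dt$ be its Fourier transform (in the sense of Plancherel), i.e. the boundary value on the imaginary axis of the transfer function $F$, and let $S(\omega)=\widehat F(\omega)\widehat F(\omega)^*$ be the spectral density of $Z$. Assume that $\|F\|_\infty=\operatorname{ess\,sup}_{\omega\in\mathbb R}\|\widehat F(\omega)\|<\infty$, where $\|\cdot\|$ is the operator norm of matrices. Let $K(s-t)=\mathbf E(Z(s)Z(t)^{\mathsf T})=\int_{-\infty}^{\min(s,t)}f(s-\tau)f(t-\tau)^{\mathsf T}\,d\tau$ be the covariance function of $Z$ and, for $T>0$, let $K_T$ be the covariance operator on $L^2([0,T],\mathbb C^p)$ given by $(K_T\psi)(s)=\int_0^T K(s-t)\psi(t)\,dt$. Let $\varphi$ be a complex function that is analytic in a neighbourhood of the interval $[0,\|F\|_\infty^2]$ in the complex plane and satisfies $\varphi(0)=0$. Then, with $\varphi(K_T)$ and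 $\varphi(S(\omega))$ understood in the sense of the functional calculus, the operator $\varphi(K_T)$ is of trace class for every $T>0$, the function $\omega\mapsto\operatorname{Tr}\varphi(S(\omega))$ is integrable over $\mathbb R$, and $$\lim_{T\to+\infty}\frac1T\operatorname{Tr}\varphi(K_T)=J_\varphi(F):=\frac1{2\pi}\int_{\mathbb R}\operatorname{Tr}\varphi(S(\omega))\,d\omega .$$ If, moreover, $\varphi$ is analytic in a neighbourhood of the closed disc $\{|z|\le\|F\|_\infty^2\}$, then $\operatorname{Tr}\varphi(K_T)=\sum_{k=1}^\infty\frac{\varphi^{(k)}(0)}{k!}\operatorname{Tr}(K_T^k)$ for every $T>0$, with an absolutely convergent series. -/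

import Mathlib

open MeasureTheory Filter Topology

noncomputable section

namespace CovAn

/-! ### The system -/

/-- Impulse responses `f : ℝ₊ → ℝ^{p×m}`. Such a function is represented by a function on `ℝ`,
only the values of which on `[0, ∞)` are used. -/
abbrev ImpulseResponse (p m : ℕ) := ℝ → Matrix (Fin p) (Fin m) ℝ

/-- `f ∈ L²(ℝ₊, ℝ^{p×m})`: every entry of `f` is (measurable and) square integrable
on `[0, ∞)`. -/
def SqIntegrable {p m : ℕ} (f : ImpulseResponse p m) : Prop :=
  ∀ i k, MemLp (fun t => f t i k) 2 (volume.restrict (Set.Ici (0 : ℝ)))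

/-- The `(i, k)` entry of `f`, extended by zero to `(-∞, 0)`. -/
def extend {p m : ℕ} (f : ImpulseResponse p m) (i : Fin p) (k : Fin m) : ℝ → ℝ :=
  Set.indicator (Set.Ici 0) (fun t => f t i k)

theorem memLp_extend {p m : ℕ} {f : ImpulseResponse p m} (hf : SqIntegrable f)
    (i : Fin p) (k : Fin m) : MemLp (extend f i k) 2 volume :=
  (memLp_indicator_iff_restrict measurableSet_Ici).2 (hf i k)

theorem memLp_extend_ofReal {p m : ℕ} {f : ImpulseResponse p m} (hf : SqIntegrable f)
    (i : Fin p) (k : Fin m) : MemLp (fun t => (extend f i k t : ℂ)) 2 volume :=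
  (memLp_extend hf i k).ofReal

/-! ### Frequency domain -/

open scoped FourierTransform in
/-- The boundary value `F̂(ω) = F(iω) = ∫_{ℝ₊} e^{-iωt} f(t) dt` of the transfer function: the
entrywise Fourier transform of `f` in the sense of Plancherel, defined up to equality for almost
every `ω`. Mathlib's transform on `L²(ℝ)` has the kernel `e^{-2πiξt}`, hence the argument
`ξ = ω / 2π`. -/
def freqResponse {p m : ℕ} (f : ImpulseResponse p m) (hf : SqIntegrable f) (ω : ℝ) :
    Matrix (Fin p) (Fin m) ℂ :=
  Matrix.of fun i k =>
    (𝓕 (MemLp.toLp _ (memLp_extend_ofReal hf i k)) : Lp ℂ 2 (volume : Measure ℝ))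
      (ω / (2 * Real.pi))

open scoped Matrix in
/-- The spectral density `S(ω) = F̂(ω) F̂(ω)^*`. -/
def spectralDensity {p m : ℕ} (f : ImpulseResponse p m) (hf : SqIntegrable f) (ω : ℝ) :
    Matrix (Fin p) (Fin p) ℂ :=
  freqResponse f hf ω * (freqResponse f hf ω)ᴴ

open scoped Matrix.Norms.L2Operator in
/-- The norm `‖F‖_∞ = ess sup_ω ‖F̂(ω)‖` in `[0, ∞]`, where `‖·‖` is the operator norm of matrices
with respect to the Euclidean norms. -/
def hInfNorm {p m : ℕ} (f : ImpulseResponse p m) (hf : SqIntegrable f) : ENNReal :=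
  essSup (fun ω => ‖freqResponse f hf ω‖ₑ) (volume : Measure ℝ)

open scoped Matrix.Norms.L2Operator in
/-- `Tr φ(S(ω))`, where `φ(S(ω))` is the function `φ` of the Hermitian matrix `S(ω)`. -/
def traceSpectral {p m : ℕ} (f : ImpulseResponse p m) (hf : SqIntegrable f) (φ : ℂ → ℂ) (ω : ℝ) :
    ℂ :=
  Matrix.trace (cfc φ (spectralDensity f hf ω))

/-- The covariance-analytic functional `J_φ(F) = (1/2π) ∫_ℝ Tr φ(S(ω)) dω`. -/
def covAnalyticCost {p m : ℕ} (f : ImpulseResponse p m) (hf : SqIntegrable f) (φ : ℂ → ℂ) : ℂ :=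
  (1 / (2 * Real.pi)) * ∫ ω : ℝ, traceSpectral f hf φ ω

/-! ### The covariance function and the covariance operator -/

open scoped Matrix in
/-- The covariance function
`K(s - t) = E(Z(s) Z(t)^T) = ∫_{-∞}^{min(s,t)} f(s - τ) f(t - τ)^T dτ`
of the stationary Gaussian process `Z(t) = ∫_{-∞}^t f(t - τ) dW(τ)`, with `s = u` and `t = 0`. -/
def covFun {p m : ℕ} (f : ImpulseResponse p m) (u : ℝ) : Matrix (Fin p) (Fin p) ℝ :=
  Matrix.of fun i j => ∫ τ in Set.Iic (min u 0), (f (u - τ) * (f (0 - τ))ᵀ) i j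

/-- The Hilbert space `L²([0,T], ℂ^p)`. -/
abbrev L2 (p : ℕ) (T : ℝ) : Type :=
  Lp (EuclideanSpace ℂ (Fin p)) 2 (volume.restrict (Set.Icc (0 : ℝ) T))

open scoped Matrix in
/-- The function `s ↦ ∫_0^T K(s - t) ψ(t) dt`. -/
def covIntegral {p m : ℕ} (f : ImpulseResponse p m) (T : ℝ) (ψ : ℝ → EuclideanSpace ℂ (Fin p))
    (s : ℝ) : EuclideanSpace ℂ (Fin p) :=
  WithLp.toLp 2 fun i =>
    ∫ t in Set.Icc 0 T, ((covFun f (s - t)).map (fun x : ℝ => (x : ℂ)) *ᵥ (ψ t).ofLp) i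

theorem covFun_eq {p m : ℕ} (f : ImpulseResponse p m) (u : ℝ) (i j : Fin p) :
    covFun f u i j = ∫ τ, ∑ k, extend f i k (u - τ) * extend f j k (0 - τ) := by
  simp only [covFun, Matrix.of_apply]
  rw [← integral_indicator measurableSet_Iic]
  congr 1
  ext τ
  simp only [Set.indicator, extend, Set.mem_Iic, Set.mem_Ici, Matrix.mul_apply,
    Matrix.transpose_apply]
  by_cases h1 : τ ≤ u <;> by_cases h2 : τ ≤ 0 <;> simp [h1, h2]

theorem aestronglyMeasurable_covFun {p m : ℕ} {f : ImpulseResponse p m} (hf : SqIntegrable f)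
    (i j : Fin p) : AEStronglyMeasurable (fun u => covFun f u i j) volume := by
  simp only [covFun_eq]
  have h : AEStronglyMeasurable
      (fun z : ℝ × ℝ => ∑ k, extend f i k (z.1 - z.2) * extend f j k (0 - z.2))
      ((volume : Measure ℝ).prod volume) := by
    refine Finset.aestronglyMeasurable_fun_sum _ fun k _ => ?_
    refine AEStronglyMeasurable.mul ?_ ?_
    · exact (memLp_extend hf i k).1.comp_quasiMeasurePreserving
        (quasiMeasurePreserving_sub volume volume)
    · have h0 : AEStronglyMeasurable (fun τ : ℝ => extend f j k (0 - τ)) volume :=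
        (memLp_extend hf j k).1.comp_quasiMeasurePreserving
          (Measure.measurePreserving_sub_left volume 0).quasiMeasurePreserving
      exact h0.comp_snd
  exact h.integral_prod_right'

theorem exists_covFun_bound {p m : ℕ} {f : ImpulseResponse p m} (hf : SqIntegrable f) :
    ∃ C : ℝ, 0 ≤ C ∧ ∀ u i j, |covFun f u i j| ≤ C := by
  have hsq : ∀ i k, Integrable (fun t => (extend f i k t) ^ 2) volume := fun i k =>
    (memLp_extend hf i k).integrable_sq
  have hnn : ∀ i k, 0 ≤ ∫ t, (extend f i k t) ^ 2 := fun i k =>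
    integral_nonneg fun t => sq_nonneg _
  refine ⟨∑ i, ∑ j, ∑ k, ((∫ t, (extend f i k t) ^ 2) + ∫ t, (extend f j k t) ^ 2),
    ?_, fun u i j => ?_⟩
  · exact Finset.sum_nonneg fun i _ => Finset.sum_nonneg fun j _ => Finset.sum_nonneg fun k _ =>
      add_nonneg (hnn i k) (hnn j k)
  have h1 : |covFun f u i j| ≤ ∑ k, ((∫ t, (extend f i k t) ^ 2) + ∫ t, (extend f j k t) ^ 2) := by
    have hi : ∀ k, Integrable (fun τ => (extend f i k (u - τ)) ^ 2) volume := fun k =>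
      (hsq i k).comp_sub_left u
    have hj : ∀ k, Integrable (fun τ => (extend f j k (0 - τ)) ^ 2) volume := fun k =>
      (hsq j k).comp_sub_left 0
    have e : ∑ k, ((∫ t, (extend f i k t) ^ 2) + ∫ t, (extend f j k t) ^ 2)
        = ∫ τ, ∑ k, ((extend f i k (u - τ)) ^ 2 + (extend f j k (0 - τ)) ^ 2) := by
      refine Eq.trans ?_ (integral_finsetSum Finset.univ fun k _ => (hi k).add (hj k)).symm
      refine Finset.sum_congr rfl fun k _ => ?_
      refine Eq.trans ?_ (integral_add (hi k) (hj k)).symm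
      congr 1
      · exact (integral_sub_left_eq_self (fun t => (extend f i k t) ^ 2) volume u).symm
      · exact (integral_sub_left_eq_self (fun t => (extend f j k t) ^ 2) volume 0).symm
    rw [e, covFun_eq, ← Real.norm_eq_abs]
    refine norm_integral_le_of_norm_le
      (integrable_finsetSum _ fun k _ => (hi k).add (hj k)) (ae_of_all _ fun τ => ?_)
    refine (norm_sum_le _ _).trans (Finset.sum_le_sum fun k _ => ?_)
    rw [Real.norm_eq_abs, abs_le]
    constructor <;>
      nlinarith [sq_nonneg (extend f i k (u - τ) + extend f j k (0 - τ)),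
        sq_nonneg (extend f i k (u - τ) - extend f j k (0 - τ)),
        sq_nonneg (extend f i k (u - τ)), sq_nonneg (extend f j k (0 - τ))]
  refine h1.trans ?_
  have h2 : ∀ i j, 0 ≤ ∑ k, ((∫ t, (extend f i k t) ^ 2) + ∫ t, (extend f j k t) ^ 2) :=
    fun i j => Finset.sum_nonneg fun k _ => add_nonneg (hnn i k) (hnn j k)
  refine (Finset.single_le_sum (f := fun j => ∑ k, ((∫ t, (extend f i k t) ^ 2)
    + ∫ t, (extend f j k t) ^ 2)) (fun j _ => h2 i j) (Finset.mem_univ j)).trans ?_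
  exact Finset.single_le_sum (f := fun i => ∑ j, ∑ k, ((∫ t, (extend f i k t) ^ 2)
    + ∫ t, (extend f j k t) ^ 2)) (fun i _ => Finset.sum_nonneg fun j _ => h2 i j)
    (Finset.mem_univ i)

theorem integrable_coord {p : ℕ} {T : ℝ} (ψ : L2 p T) (j : Fin p) :
    Integrable (fun t => (ψ t).ofLp j) (volume.restrict (Set.Icc (0 : ℝ) T)) :=
  (EuclideanSpace.proj (𝕜 := ℂ) j).integrable_comp
    ((Lp.memLp ψ).integrable (by norm_num))

theorem integrable_integrand {p m : ℕ} {f : ImpulseResponse p m} (hf : SqIntegrable f) {T : ℝ}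
    (ψ : L2 p T) (s : ℝ) (i j : Fin p) :
    Integrable (fun t => (covFun f (s - t) i j : ℂ) * (ψ t).ofLp j)
      (volume.restrict (Set.Icc (0 : ℝ) T)) := by
  obtain ⟨C, _, hC⟩ := exists_covFun_bound hf
  refine (integrable_coord ψ j).bdd_mul (c := C) ?_ (ae_of_all _ fun t => ?_)
  · have h : AEStronglyMeasurable (fun t => covFun f (s - t) i j) volume :=
      (aestronglyMeasurable_covFun hf i j).comp_quasiMeasurePreserving
        (Measure.measurePreserving_sub_left volume s).quasiMeasurePreserving
    exact (Complex.continuous_ofReal.comp_aestronglyMeasurable h).restrict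
  · simpa using hC (s - t) i j

theorem covIntegral_apply {p m : ℕ} {f : ImpulseResponse p m} (hf : SqIntegrable f) {T : ℝ}
    (ψ : L2 p T) (s : ℝ) (i : Fin p) :
    (covIntegral f T ψ s).ofLp i
      = ∑ j, ∫ t in Set.Icc 0 T, (covFun f (s - t) i j : ℂ) * (ψ t).ofLp j := by
  rw [← integral_finsetSum _ fun j _ => integrable_integrand hf ψ s i j]
  rfl

theorem aestronglyMeasurable_covIntegral {p m : ℕ} {f : ImpulseResponse p m}
    (hf : SqIntegrable f) {T : ℝ} (ψ : L2 p T) :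
    AEStronglyMeasurable (covIntegral f T ψ) (volume.restrict (Set.Icc (0 : ℝ) T)) := by
  have h : AEStronglyMeasurable (fun s => (covIntegral f T ψ s).ofLp)
      (volume.restrict (Set.Icc (0 : ℝ) T)) := by
    refine (aemeasurable_pi_lambda _ fun i => ?_).aestronglyMeasurable
    simp only [covIntegral_apply hf]
    refine Finset.aemeasurable_fun_sum _ fun j _ => ?_
    refine AEStronglyMeasurable.aemeasurable ?_
    refine AEStronglyMeasurable.integral_prod_right'
      (f := fun z : ℝ × ℝ => (covFun f (z.1 - z.2) i j : ℂ) * (ψ z.2).ofLp j) ?_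
    refine AEStronglyMeasurable.mul ?_ (integrable_coord ψ j).1.comp_snd
    have h1 : AEStronglyMeasurable (fun z : ℝ × ℝ => covFun f (z.1 - z.2) i j)
        ((volume : Measure ℝ).prod volume) :=
      (aestronglyMeasurable_covFun hf i j).comp_quasiMeasurePreserving
        (quasiMeasurePreserving_sub volume volume)
    rw [Measure.prod_restrict]
    exact (Complex.continuous_ofReal.comp_aestronglyMeasurable h1).restrict
  exact (PiLp.continuous_toLp 2 _).comp_aestronglyMeasurable h

theorem exists_covIntegral_bound {p m : ℕ} {f : ImpulseResponse p m} (hf : SqIntegrable f)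
    (T : ℝ) : ∃ C : ℝ, 0 ≤ C ∧ ∀ (ψ : L2 p T) (s : ℝ), ‖covIntegral f T ψ s‖ ≤ C * ‖ψ‖ := by
  obtain ⟨C, hC0, hC⟩ := exists_covFun_bound hf
  set μ : Measure ℝ := volume.restrict (Set.Icc (0 : ℝ) T) with hμ
  set D : ℝ := (μ Set.univ).toReal ^ ((1 : ℝ) / 2) with hD
  have hD0 : 0 ≤ D := Real.rpow_nonneg ENNReal.toReal_nonneg _
  have hL1 : ∀ ψ : L2 p T, ∫ t, ‖ψ t‖ ∂μ ≤ ‖ψ‖ * D := by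
    intro ψ
    have h1 := eLpNorm_le_eLpNorm_mul_rpow_measure_univ (p := 1) (q := 2) (μ := μ) (by norm_num)
      (Lp.aestronglyMeasurable ψ)
    rw [integral_norm_eq_lintegral_enorm (Lp.aestronglyMeasurable ψ), ← eLpNorm_one_eq_lintegral_enorm]
    have hfin : eLpNorm ψ 2 μ * (μ Set.univ) ^ (1 / (1 : ENNReal).toReal - 1 / (2 : ENNReal).toReal)
        ≠ ⊤ := by
      refine ENNReal.mul_ne_top (Lp.memLp ψ).2.ne ?_
      refine ENNReal.rpow_ne_top_of_nonneg (by norm_num) (measure_ne_top _ _)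
    refine (ENNReal.toReal_mono hfin h1).trans (le_of_eq ?_)
    rw [ENNReal.toReal_mul, ← ENNReal.toReal_rpow, Lp.norm_def, hD]
    norm_num
    exact Or.inl rfl
  refine ⟨(∑ _i : Fin p, ∑ _j : Fin p, C) * D,
    mul_nonneg (Finset.sum_nonneg fun _ _ => Finset.sum_nonneg fun _ _ => hC0) hD0, fun ψ s => ?_⟩
  have hint : Integrable (fun t => ‖ψ t‖) μ := ((Lp.memLp ψ).integrable (by norm_num)).norm
  have hij : ∀ i j, ‖∫ t in Set.Icc 0 T, (covFun f (s - t) i j : ℂ) * (ψ t).ofLp j‖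
      ≤ C * (‖ψ‖ * D) := by
    intro i j
    refine (norm_integral_le_of_norm_le (hint.const_mul C) (ae_of_all _ fun t => ?_)).trans ?_
    · rw [norm_mul, Complex.norm_real, Real.norm_eq_abs]
      exact mul_le_mul (hC _ i j) (PiLp.norm_apply_le (ψ t) j) (norm_nonneg _) hC0
    · rw [integral_const_mul]
      exact mul_le_mul_of_nonneg_left (hL1 ψ) hC0
  have hi : ∀ i, ‖(covIntegral f T ψ s).ofLp i‖ ≤ ∑ _j : Fin p, C * (‖ψ‖ * D) := by
    intro i
    rw [covIntegral_apply hf]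
    exact (norm_sum_le _ _).trans (Finset.sum_le_sum fun j _ => hij i j)
  have hn : ‖covIntegral f T ψ s‖ ≤ ∑ i, ‖(covIntegral f T ψ s).ofLp i‖ := by
    rw [EuclideanSpace.norm_eq, Real.sqrt_le_left (Finset.sum_nonneg fun _ _ => norm_nonneg _)]
    exact Finset.sum_sq_le_sq_sum_of_nonneg fun _ _ => norm_nonneg _
  refine hn.trans ((Finset.sum_le_sum fun i _ => hi i).trans (le_of_eq ?_))
  simp only [Finset.sum_const, Finset.card_univ, Fintype.card_fin, nsmul_eq_mul]
  ring

theorem memLp_covIntegral {p m : ℕ} {f : ImpulseResponse p m} (hf : SqIntegrable f) {T : ℝ}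
    (ψ : L2 p T) : MemLp (covIntegral f T ψ) 2 (volume.restrict (Set.Icc (0 : ℝ) T)) := by
  obtain ⟨C, _, hC⟩ := exists_covIntegral_bound hf T
  exact MemLp.of_bound (aestronglyMeasurable_covIntegral hf ψ) (C * ‖ψ‖) (ae_of_all _ (hC ψ))

theorem exists_toLp_covIntegral_bound {p m : ℕ} {f : ImpulseResponse p m} (hf : SqIntegrable f)
    (T : ℝ) : ∃ C : ℝ, ∀ ψ : L2 p T, ‖(memLp_covIntegral hf ψ).toLp _‖ ≤ C * ‖ψ‖ := by
  obtain ⟨C, hC0, hC⟩ := exists_covIntegral_bound hf T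
  refine ⟨(measureUnivNNReal (volume.restrict (Set.Icc (0 : ℝ) T)) : ℝ) ^
    (2 : ENNReal).toReal⁻¹ * C, fun ψ => ?_⟩
  have h := Lp.norm_le_of_ae_bound (f := (memLp_covIntegral hf ψ).toLp _)
    (mul_nonneg hC0 (norm_nonneg ψ))
    ((memLp_covIntegral hf ψ).coeFn_toLp.mono fun s hs => by rw [hs]; exact hC ψ s)
  rwa [← mul_assoc] at h

theorem covIntegral_congr_add {p m : ℕ} {f : ImpulseResponse p m} (hf : SqIntegrable f) {T : ℝ}
    (ψ χ : L2 p T) (s : ℝ) :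
    covIntegral f T (ψ + χ : L2 p T) s = covIntegral f T ψ s + covIntegral f T χ s := by
  ext i
  rw [PiLp.add_apply, covIntegral_apply hf, covIntegral_apply hf, covIntegral_apply hf,
    ← Finset.sum_add_distrib]
  refine Finset.sum_congr rfl fun j _ => ?_
  rw [← integral_add (integrable_integrand hf ψ s i j) (integrable_integrand hf χ s i j)]
  refine integral_congr_ae ((Lp.coeFn_add ψ χ).mono fun t ht => ?_)
  simp only [ht, Pi.add_apply, PiLp.add_apply, mul_add]

theorem covIntegral_congr_smul {p m : ℕ} {f : ImpulseResponse p m} (hf : SqIntegrable f) {T : ℝ}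
    (c : ℂ) (ψ : L2 p T) (s : ℝ) :
    covIntegral f T (c • ψ : L2 p T) s = c • covIntegral f T ψ s := by
  ext i
  rw [PiLp.smul_apply, covIntegral_apply hf, covIntegral_apply hf, smul_eq_mul, Finset.mul_sum]
  refine Finset.sum_congr rfl fun j _ => ?_
  rw [← integral_const_mul]
  refine integral_congr_ae ((Lp.coeFn_smul c ψ).mono fun t ht => ?_)
  simp only [ht, Pi.smul_apply, PiLp.smul_apply, smul_eq_mul]
  ring

/-- The covariance operator `K_T` on `L²([0,T], ℂ^p)`: `(K_T ψ)(s) = ∫_0^T K(s - t) ψ(t) dt`. -/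
def covOperator {p m : ℕ} (f : ImpulseResponse p m) (hf : SqIntegrable f) (T : ℝ) :
    L2 p T →L[ℂ] L2 p T :=
  LinearMap.mkContinuousOfExistsBound
    { toFun := fun ψ => (memLp_covIntegral hf ψ).toLp (covIntegral f T ψ)
      map_add' := fun ψ χ => by
        rw [← MemLp.toLp_add]
        exact MemLp.toLp_congr _ _ (ae_of_all _ (covIntegral_congr_add hf ψ χ))
      map_smul' := fun c ψ => by
        rw [RingHom.id_apply, ← MemLp.toLp_const_smul]
        exact MemLp.toLp_congr _ _ (ae_of_all _ (covIntegral_congr_smul hf c ψ)) }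
    (exists_toLp_covIntegral_bound hf T)

/-! ### Traces of operators on a Hilbert space -/

/-- `A` is of trace class: `∑ᵢ ⟨eᵢ, |A| eᵢ⟩ < ∞` for every Hilbert basis `(eᵢ)`,
where `|A| = √(A^* A)`. -/
def IsTraceClass {H : Type} [NormedAddCommGroup H] [InnerProductSpace ℂ H] [CompleteSpace H]
    (A : H →L[ℂ] H) : Prop :=
  ∀ (ι : Type) (b : HilbertBasis ι ℂ H),
    Summable fun i => RCLike.re (inner ℂ (b i) (CFC.abs A (b i)))

/-- The trace `∑ᵢ ⟨eᵢ, A eᵢ⟩` with respect to some Hilbert basis `(eᵢ)`. For an operator of trace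
class, the series converges absolutely and its sum is the same for all Hilbert bases. -/
def opTrace {H : Type} [NormedAddCommGroup H] [InnerProductSpace ℂ H] [CompleteSpace H]
    (A : H →L[ℂ] H) : ℂ :=
  ∑' i, inner ℂ ((exists_hilbertBasis ℂ H).choose_spec.choose i)
    (A ((exists_hilbertBasis ℂ H).choose_spec.choose i))

end CovAn

end

/-!
The spectral density `S` is the Fourier transform of the covariance function, so by Plancherel's
theorem the covariance operator is a truncated convolution ("Toeplitz") operator:
`⟪ψ, K_T χ⟫ = ∫ ⟪ψ̂(ξ), S(ξ) χ̂(ξ)⟫ dξ` for `ψ, χ ∈ L²([0,T], ℂ^p)` extended by zero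
(`isToeplitz_covOperator`). In particular `0 ≤ K_T` and `‖K_T‖ ≤ ‖S‖_∞ = ‖F‖_∞²`, and the spectrum
of `K_T` lies in `[0, ‖F‖_∞²]`. Frequencies are `ξ = ω / 2π` throughout, which accounts for the
factor `1 / 2π` in the limit.

*Traces.* The plane waves `u_{ξ,a}(t) = e^{2πiξt} e_a` on `[0,T]` form a continuous resolution of
the identity of `L²([0,T], ℂ^p)`, so that `Tr X = ∫ ∑ₐ ⟪u_{ξ,a}, X u_{ξ,a}⟫ dξ` for positive `X`
(`hasSum_inner_mul_self`). For `X = K_T` this is `T ∫ Tr S(ξ) dξ < ∞`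
(`planeWaveTrace_pow_one`); hence all positive powers of `K_T` have a trace
(`IsToeplitz.hasSum_inner_pow`).

*Powers.* The plane wave `u_{ξ,v}` is nearly an eigenvector: the squared norm of
`K_T u_{ξ,v} - u_{ξ, S(ξ) v}` is at most `‖v‖²` times the integral over `η` of
`|D_T(ξ - η)|² ‖S(η) - S(ξ)‖²`, where `D_T` is the Dirichlet kernel
(`IsToeplitz.enorm_planeWave_sub_le`). After division by `T`, the integral of this oscillation over
`ξ` tends to zero, by continuity of translations in `L²` and dominated convergence
(`tendsto_lintegral_oscillation_div`). With the Cauchy-Schwarz inequality in `ξ` this gives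
`Tr K_Tⁿ / T → ∫ Tr S(ξ)ⁿ dξ` for all `n ≥ 1` (`tendsto_planeWaveTrace_pow`).

*Functions.* As `φ(0) = 0`, `φ(z) = z g(z)` with `g` continuous on `[0, ‖F‖_∞²]`. If a polynomial
`q` is uniformly `ε`-close to `g` there, then `φ(X)` and `X q(X)` have diagonal matrix elements
within `ε ⟪x, X x⟫` of each other for every positive `X` with spectrum in the interval
(`norm_inner_cfc_sub_le`); applied to `X = K_T` and to `X = S(ξ)`, this bounds the difference of the
traces by `ε Tr K_T` and by `ε ∫ Tr S(ξ) dξ`, and Weierstrass' theorem reduces the limit to powers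
(`tendsto_opTrace_cfc`). The same estimate, with the partial sums of the Taylor series of `g` in
place of `q`, gives the expansion of `Tr φ(K_T)` (`HasPowerTraces.hasSum_taylor`).
-/

open MeasureTheory Filter Topology

noncomputable section

namespace CovAn

/-! ### The Fourier transform on `L²(ℝ)` -/

section Fourier

open scoped FourierTransform SchwartzMap ContDiff

variable {V : Type*} [NormedAddCommGroup V] [InnerProductSpace ℂ V] [CompleteSpace V]

/-- The transform of Plancherel is defined by duality: it is moved onto the test function. -/
theorem integral_smul_fourier_Lp (u : Lp V 2 (volume : Measure ℝ)) (g : 𝓢(ℝ, ℂ)) :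
    ∫ x, g x • (𝓕 u : Lp V 2 (volume : Measure ℝ)) x = ∫ x, (𝓕 g) x • u x := by
  have h := congrArg (fun d : 𝓢'(ℝ, V) => d g) (Lp.fourier_toTemperedDistribution_eq u)
  simp only [TemperedDistribution.fourier_apply, Lp.toTemperedDistribution_apply] at h
  exact h.symm

/-- A locally integrable function is the Fourier transform of `u ∈ L²` as soon as it pairs correctly
with all test functions of compact support. -/
theorem fourier_Lp_ae_eq_of_forall (u : Lp V 2 (volume : Measure ℝ)) {v : ℝ → V}
    (hv : LocallyIntegrable v)
    (h : ∀ g : 𝓢(ℝ, ℂ), HasCompactSupport g →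
      ∫ x, (𝓕 g) x • u x = ∫ x, g x • v x) :
    (𝓕 u : Lp V 2 (volume : Measure ℝ)) =ᵐ[volume] v := by
  refine ae_eq_of_integral_contDiff_smul_eq
    ((Lp.memLp _).locallyIntegrable (by norm_num)) hv fun g hg hgc => ?_
  have hc : HasCompactSupport (fun x => (g x : ℂ)) :=
    hgc.comp_left (g := fun x : ℝ => (x : ℂ)) Complex.ofReal_zero
  have hd : ContDiff ℝ ∞ (fun x => (g x : ℂ)) := Complex.ofRealCLM.contDiff.comp hg
  let φ : 𝓢(ℝ, ℂ) := hc.toSchwartzMap hd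
  have hφ : ∀ x, φ x = (g x : ℂ) := fun x => rfl
  have hφc : HasCompactSupport φ := hc
  have e := integral_smul_fourier_Lp u φ
  rw [h φ hφc] at e
  simp only [hφ, Complex.coe_smul] at e
  exact e

/-- On `L¹ ∩ L²` the transform of Plancherel is given by the Fourier integral. -/
theorem fourier_toLp_ae_eq {g : ℝ → V} (h1 : Integrable g) (h2 : MemLp g 2) :
    (𝓕 (h2.toLp g) : Lp V 2 (volume : Measure ℝ)) =ᵐ[volume] 𝓕 g := by
  refine fourier_Lp_ae_eq_of_forall _ ?_ fun φ _ => ?_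
  · exact (VectorFourier.fourierIntegral_continuous Real.continuous_fourierChar
      (by exact continuous_inner) h1).locallyIntegrable
  · have := VectorFourier.integral_fourierIntegral_smul_eq_flip (L := innerₗ ℝ)
      (μ := (volume : Measure ℝ)) (ν := (volume : Measure ℝ))
      (f := φ) (g := g) Real.continuous_fourierChar (by exact continuous_inner) φ.integrable h1
    rw [flip_innerₗ] at this
    rw [← show _ = ∫ x, φ x • 𝓕 g x from this]
    refine integral_congr_ae (h2.coeFn_toLp.mono fun x hx => ?_)
    simp only [hx]
    rfl

theorem memLp_fourier {g : ℝ → V} (h1 : Integrable g) (h2 : MemLp g 2) : MemLp (𝓕 g) 2 :=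
  (memLp_congr_ae (fourier_toLp_ae_eq h1 h2)).1 (Lp.memLp _)

/-- Plancherel's theorem on `L¹ ∩ L²`. -/
theorem integral_inner_fourier {g h : ℝ → V} (g1 : Integrable g) (g2 : MemLp g 2)
    (h1 : Integrable h) (h2 : MemLp h 2) :
    ∫ x, inner ℂ (𝓕 g x) (𝓕 h x) = ∫ x, inner ℂ (g x) (h x) := by
  have e := Lp.inner_fourier_eq (g2.toLp g) (h2.toLp h)
  rw [L2.inner_def, L2.inner_def] at e
  refine Eq.trans (integral_congr_ae ?_) (e.trans (integral_congr_ae ?_))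
  · filter_upwards [fourier_toLp_ae_eq g1 g2, fourier_toLp_ae_eq h1 h2] with x hx hy
    rw [hx, hy]
  · filter_upwards [g2.coeFn_toLp, h2.coeFn_toLp] with x hx hy
    rw [hx, hy]

/-- Translation of a square integrable function is modulation of its Fourier transform. -/
theorem fourier_toLp_comp_add {g : ℝ → V} (h2 : MemLp g 2) (c : ℝ)
    (h2' : MemLp (fun x => g (x + c)) 2) :
    (𝓕 (h2'.toLp _) : Lp V 2 (volume : Measure ℝ)) =ᵐ[volume]
      fun x => (Real.fourierChar (x * c) : ℂ) •
        (𝓕 (h2.toLp g) : Lp V 2 (volume : Measure ℝ)) x := by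
  have hcd : ContDiff ℝ ∞ (fun x : ℝ => (Real.fourierChar (x * c) : ℂ)) := by
    simp only [Real.fourierChar_apply]
    have h : ContDiff ℝ ∞ (fun x : ℝ => 2 * Real.pi * (x * c)) := by fun_prop
    exact ((Complex.ofRealCLM.contDiff.comp h).mul contDiff_const).cexp
  refine fourier_Lp_ae_eq_of_forall _ ?_ fun φ hφ => ?_
  · refine MemLp.locallyIntegrable (p := 2) ?_ (by norm_num)
    refine (Lp.memLp (𝓕 (h2.toLp g) : Lp V 2 (volume : Measure ℝ))).of_le
      (hcd.continuous.aestronglyMeasurable.smul (Lp.memLp _).1) (ae_of_all _ fun x => ?_)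
    rw [norm_smul, Circle.norm_coe, one_mul]
  · have hc : HasCompactSupport (fun x => (Real.fourierChar (x * c) : ℂ) * φ x) := hφ.mul_left
    have := integral_smul_fourier_Lp (h2.toLp g) (hc.toSchwartzMap (hcd.mul φ.smooth'))
    -- A translation on the side of `g` is a modulation of the test function, which keeps it in the
    -- Schwartz space because its support is compact.
    calc ∫ x, (𝓕 φ) x • (h2'.toLp _) x = ∫ x, (𝓕 φ) x • g (x + c) :=
          integral_congr_ae (h2'.coeFn_toLp.mono fun x hx => by simp only [hx])
      _ = ∫ x, (𝓕 φ) (x - c) • g x := by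
          refine Eq.trans ?_ (integral_add_right_eq_self (fun x => (𝓕 φ) (x - c) • g x) c)
          simp only [add_sub_cancel_right]
      _ = ∫ x, (𝓕 (hc.toSchwartzMap (hcd.mul φ.smooth'))) x • (h2.toLp g) x := by
          refine integral_congr_ae (h2.coeFn_toLp.mono fun x hx => ?_)
          simp only [hx]
          congr 1
          rw [SchwartzMap.fourier_coe, SchwartzMap.fourier_coe, Real.fourier_real_eq,
            Real.fourier_real_eq]
          congr 1
          ext v
          show _ = Real.fourierChar (-(v * x)) • ((Real.fourierChar (v * c) : ℂ) * φ v)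
          simp only [Circle.smul_def, smul_eq_mul]
          rw [← mul_assoc, ← Circle.coe_mul, ← AddChar.map_add_eq_mul]
          ring_nf
      _ = _ := by
          rw [← this]
          congr 1
          ext x
          show ((Real.fourierChar (x * c) : ℂ) * φ x) • _ = _
          rw [smul_smul, mul_comm]

end Fourier

/-! ### Time-limited functions and plane waves -/

section Box

open scoped FourierTransform ENNReal

variable {p : ℕ} {T : ℝ}

theorem memLp_indicator_Icc (ψ : L2 p T) : MemLp (Set.indicator (Set.Icc 0 T) ψ) 2 :=
  (memLp_indicator_iff_restrict measurableSet_Icc).2 (Lp.memLp ψ)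

theorem integrable_indicator_Icc (ψ : L2 p T) : Integrable (Set.indicator (Set.Icc 0 T) ψ) :=
  (integrable_indicator_iff measurableSet_Icc).2 ((Lp.memLp ψ).integrable (by norm_num))

/-- The Fourier transform of a function on `[0, T]`, extended by zero to `ℝ`. -/
def boxFourier (ψ : L2 p T) : ℝ → EuclideanSpace ℂ (Fin p) :=
  𝓕 (Set.indicator (Set.Icc 0 T) ψ)

theorem boxFourier_apply (ψ : L2 p T) (ξ : ℝ) :
    boxFourier ψ ξ = ∫ t in Set.Icc 0 T, Real.fourierChar (-(t * ξ)) • ψ t := by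
  rw [boxFourier, Real.fourier_real_eq, ← integral_indicator measurableSet_Icc]
  congr 1
  ext1 t
  by_cases h : t ∈ Set.Icc 0 T <;> simp [h]

theorem continuous_boxFourier (ψ : L2 p T) : Continuous (boxFourier ψ) :=
  VectorFourier.fourierIntegral_continuous Real.continuous_fourierChar
      (by exact continuous_inner) (integrable_indicator_Icc ψ)

theorem memLp_boxFourier (ψ : L2 p T) : MemLp (boxFourier ψ) 2 :=
  memLp_fourier (integrable_indicator_Icc ψ) (memLp_indicator_Icc ψ)

theorem integral_inner_boxFourier (ψ χ : L2 p T) :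
    ∫ ξ, inner ℂ (boxFourier ψ ξ) (boxFourier χ ξ) = inner ℂ ψ χ := by
  rw [L2.inner_def]
  refine (integral_inner_fourier (integrable_indicator_Icc ψ) (memLp_indicator_Icc ψ)
    (integrable_indicator_Icc χ) (memLp_indicator_Icc χ)).trans ?_
  rw [← integral_indicator measurableSet_Icc]
  congr 1
  ext1 t
  by_cases h : t ∈ Set.Icc 0 T <;> simp [h]

theorem lintegral_enorm_sq_eq_ofReal {α V : Type*} [MeasurableSpace α] {μ : Measure α}
    [NormedAddCommGroup V] {g : α → V} (hg : MemLp g 2 μ) :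
    ∫⁻ x, ‖g x‖ₑ ^ 2 ∂μ = ENNReal.ofReal (∫ x, ‖g x‖ ^ 2 ∂μ) := by
  rw [ofReal_integral_eq_lintegral_ofReal (hg.integrable_norm_pow (by norm_num)) (ae_of_all _ fun _ => by positivity)]
  refine lintegral_congr fun x => ?_
  rw [ENNReal.ofReal_pow (norm_nonneg _), ofReal_norm]

/-- Plancherel's theorem for functions on `[0, T]`. -/
theorem lintegral_boxFourier_sq (ψ : L2 p T) : ∫⁻ ξ, ‖boxFourier ψ ξ‖ₑ ^ 2 = ‖ψ‖ₑ ^ 2 := by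
  rw [lintegral_enorm_sq_eq_ofReal (memLp_boxFourier ψ), ← ofReal_norm,
    ← ENNReal.ofReal_pow (norm_nonneg _)]
  congr 1
  have h := integral_inner_boxFourier ψ ψ
  simp only [inner_self_eq_norm_sq_to_K] at h
  have h2 : ((∫ ξ, ‖boxFourier ψ ξ‖ ^ 2 : ℝ) : ℂ) = ((‖ψ‖ ^ 2 : ℝ) : ℂ) := by
    rw [← integral_complex_ofReal]
    simpa using h
  exact_mod_cast h2

theorem memLp_planeWave (T ξ : ℝ) (v : EuclideanSpace ℂ (Fin p)) :
    MemLp (fun t : ℝ => Real.fourierChar (t * ξ) • v) 2 (volume.restrict (Set.Icc 0 T)) := by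
  refine MemLp.of_bound (Continuous.aestronglyMeasurable ?_) ‖v‖ (ae_of_all _ fun t => ?_)
  · exact (Real.continuous_fourierChar.comp (by fun_prop)).smul continuous_const
  · exact (Circle.norm_smul _ _).le

/-- The plane wave `t ↦ e^{2πiξt} v` on `[0, T]`, as a linear function of the amplitude `v`. -/
def planeWave (T ξ : ℝ) : EuclideanSpace ℂ (Fin p) →ₗ[ℂ] L2 p T where
  toFun v := (memLp_planeWave T ξ v).toLp _
  map_add' v w := by
    rw [← MemLp.toLp_add]
    exact MemLp.toLp_congr _ _ (ae_of_all _ fun t => by simp [smul_add])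
  map_smul' c v := by
    rw [RingHom.id_apply, ← MemLp.toLp_const_smul]
    exact MemLp.toLp_congr _ _ (ae_of_all _ fun t => (smul_comm c _ v).symm)

theorem coeFn_planeWave (ξ : ℝ) (v : EuclideanSpace ℂ (Fin p)) :
    planeWave T ξ v =ᵐ[volume.restrict (Set.Icc 0 T)] fun t => Real.fourierChar (t * ξ) • v :=
  (memLp_planeWave T ξ v).coeFn_toLp

/-- The coefficients in the plane waves are the Fourier transform. -/
theorem inner_planeWave (ξ : ℝ) (v : EuclideanSpace ℂ (Fin p)) (ψ : L2 p T) :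
    inner ℂ (planeWave T ξ v) ψ = inner ℂ v (boxFourier ψ ξ) := by
  rw [L2.inner_def, boxFourier_apply, ← integral_inner]
  · refine integral_congr_ae ((coeFn_planeWave ξ v).mono fun t ht => ?_)
    simp only [ht, Circle.smul_def, inner_smul_left, inner_smul_right, AddChar.map_neg_eq_inv,
      Circle.coe_inv_eq_conj]
  · have h : Integrable ψ (volume.restrict (Set.Icc 0 T)) := (Lp.memLp ψ).integrable (by norm_num)
    refine h.mono ((Continuous.aestronglyMeasurable ?_).smul h.1) (ae_of_all _ fun t => ?_)
    · exact continuous_subtype_val.comp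
        (Real.continuous_fourierChar.comp (continuous_id.mul continuous_const).neg)
    · exact (Circle.norm_smul _ _).le

/-- The Dirichlet kernel `∫_0^T e^{2πiut} dt`. -/
def dirichletKernel (T u : ℝ) : ℂ := ∫ t in Set.Icc 0 T, (Real.fourierChar (t * u) : ℂ)

theorem boxFourier_planeWave (ξ η : ℝ) (v : EuclideanSpace ℂ (Fin p)) :
    boxFourier (planeWave T ξ v) η = dirichletKernel T (ξ - η) • v := by
  rw [boxFourier_apply, dirichletKernel, ← integral_smul_const]
  refine integral_congr_ae ((coeFn_planeWave ξ v).mono fun t ht => ?_)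
  simp only [ht]
  rw [smul_smul, ← AddChar.map_add_eq_mul, Circle.smul_def]
  ring_nf

theorem dirichletKernel_eq_fourier (T u : ℝ) :
    dirichletKernel T u = 𝓕 (Set.indicator (Set.Icc 0 T) (fun _ => (1 : ℂ))) (-u) := by
  rw [dirichletKernel, Real.fourier_real_eq, ← integral_indicator measurableSet_Icc]
  congr 1
  ext1 t
  by_cases h : t ∈ Set.Icc 0 T <;> simp [h, Circle.smul_def]

theorem dirichletKernel_zero (hT : 0 ≤ T) : dirichletKernel T 0 = T := by
  simp [dirichletKernel, hT]

/-- The Dirichlet kernels are rescalings of each other. -/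
theorem dirichletKernel_mul (hT : 0 < T) (u : ℝ) :
    dirichletKernel T u = T * dirichletKernel 1 (T * u) := by
  simp only [dirichletKernel]
  rw [integral_Icc_eq_integral_Ioc, integral_Icc_eq_integral_Ioc,
    ← intervalIntegral.integral_of_le hT.le, ← intervalIntegral.integral_of_le zero_le_one]
  have := intervalIntegral.integral_comp_mul_left (a := 0) (b := 1)
    (fun t => (Real.fourierChar (t * u) : ℂ)) hT.ne'
  simp only [mul_zero, mul_one] at this
  have h2 : ∀ t, (Real.fourierChar (t * (T * u)) : ℂ) = Real.fourierChar (T * t * u) := fun t => by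
    ring_nf
  simp only [h2, this]
  rw [Complex.real_smul]
  push_cast
  rw [mul_inv_cancel_left₀ (by exact_mod_cast hT.ne')]

theorem continuous_dirichletKernel (T : ℝ) : Continuous (dirichletKernel T) := by
  have h : Continuous (𝓕 (Set.indicator (Set.Icc 0 T) (fun _ => (1 : ℂ)))) :=
    VectorFourier.fourierIntegral_continuous Real.continuous_fourierChar (by exact continuous_inner)
      ((integrable_indicator_iff measurableSet_Icc).2 (integrable_const _))
  exact (h.comp continuous_neg).congr fun u => (dirichletKernel_eq_fourier T u).symm

/-- Plancherel's theorem for the indicator function of `[0, T]`. -/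
theorem lintegral_dirichletKernel_sq (hT : 0 ≤ T) :
    ∫⁻ u, ‖dirichletKernel T u‖ₑ ^ 2 = ENNReal.ofReal T := by
  set g : ℝ → ℂ := Set.indicator (Set.Icc 0 T) (fun _ => (1 : ℂ)) with hg
  have h1 : Integrable g := (integrable_indicator_iff measurableSet_Icc).2 (integrable_const _)
  have h2 : MemLp g 2 := (memLp_indicator_iff_restrict measurableSet_Icc).2 (memLp_const _)
  simp only [dirichletKernel_eq_fourier]
  rw [(Measure.measurePreserving_neg volume).lintegral_comp_emb
    (MeasurableEquiv.neg ℝ).measurableEmbedding (fun u => ‖𝓕 g u‖ₑ ^ 2),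
    lintegral_enorm_sq_eq_ofReal (memLp_fourier h1 h2)]
  congr 1
  have h := integral_inner_fourier h1 h2 h1 h2
  simp only [inner_self_eq_norm_sq_to_K] at h
  have h3 : ∫ x, ((‖g x‖ : ℂ)) ^ 2 = T := by
    have : ∀ x, ((‖g x‖ : ℂ)) ^ 2 = g x := fun x => by
      by_cases h : x ∈ Set.Icc 0 T <;> simp [hg, h]
    rw [integral_congr_ae (ae_of_all _ this), hg, integral_indicator measurableSet_Icc]
    simp [hT]
  have h4 : ((∫ ξ, ‖𝓕 g ξ‖ ^ 2 : ℝ) : ℂ) = (T : ℂ) := by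
    rw [← integral_complex_ofReal, ← h3]
    simpa using h
  exact_mod_cast h4

theorem inner_planeWave_planeWave (hT : 0 ≤ T) (ξ : ℝ) (v w : EuclideanSpace ℂ (Fin p)) :
    inner ℂ (planeWave T ξ v) (planeWave T ξ w) = T * inner ℂ v w := by
  rw [inner_planeWave, boxFourier_planeWave, sub_self, dirichletKernel_zero hT, inner_smul_right]

theorem norm_planeWave (hT : 0 ≤ T) (ξ : ℝ) (v : EuclideanSpace ℂ (Fin p)) :
    ‖planeWave T ξ v‖ = √T * ‖v‖ := by
  have h : ‖planeWave T ξ v‖ ^ 2 = T * ‖v‖ ^ 2 := by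
    have := inner_planeWave_planeWave hT ξ v v
    rw [inner_self_eq_norm_sq_to_K, inner_self_eq_norm_sq_to_K] at this
    have h2 : ((‖planeWave T ξ v‖ ^ 2 : ℝ) : ℂ) = ((T * ‖v‖ ^ 2 : ℝ) : ℂ) := by
      push_cast
      exact this
    exact Complex.ofReal_injective h2
  rw [← Real.sqrt_sq (norm_nonneg (planeWave T ξ v)), h, Real.sqrt_mul hT,
    Real.sqrt_sq (norm_nonneg _)]

theorem continuous_planeWave (hT : 0 ≤ T) (v : EuclideanSpace ℂ (Fin p)) :
    Continuous (fun ξ => planeWave T ξ v) := by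
  refine continuous_iff_continuousAt.2 fun ξ => ?_
  refine tendsto_iff_norm_sub_tendsto_zero.2 ?_
  -- All plane waves have the same norm, so their distance is determined by the inner product,
  -- which is a value of the Dirichlet kernel.
  have key : ∀ η, ‖planeWave T η v - planeWave T ξ v‖ ^ 2
      = 2 * (T * ‖v‖ ^ 2) - 2 * (dirichletKernel T (ξ - η)).re * ‖v‖ ^ 2 := by
    intro η
    rw [@norm_sub_sq ℂ, norm_planeWave hT, norm_planeWave hT, mul_pow, Real.sq_sqrt hT,
      inner_planeWave, boxFourier_planeWave, inner_smul_right, inner_self_eq_norm_sq_to_K]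
    have : RCLike.re (dirichletKernel T (ξ - η) * ((‖v‖ : ℂ)) ^ 2)
        = (dirichletKernel T (ξ - η)).re * ‖v‖ ^ 2 := by
      rw [← Complex.ofReal_pow]
      exact Complex.re_mul_ofReal _ _
    erw [this]
    ring
  have hlim : Tendsto (fun η => √(‖planeWave T η v - planeWave T ξ v‖ ^ 2)) (𝓝 ξ) (𝓝 0) := by
    have hc : Continuous fun η => √(2 * (T * ‖v‖ ^ 2)
        - 2 * (dirichletKernel T (ξ - η)).re * ‖v‖ ^ 2) := by
      have := continuous_dirichletKernel T
      fun_prop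
    have h0 := hc.tendsto ξ
    simp only [sub_self, dirichletKernel_zero hT, Complex.ofReal_re] at h0
    rw [show 2 * (T * ‖v‖ ^ 2) - 2 * T * ‖v‖ ^ 2 = 0 by ring, Real.sqrt_zero] at h0
    simpa only [key] using h0
  simpa only [Real.sqrt_sq (norm_nonneg _)] using hlim

end Box

/-! ### Hilbert bases and plane waves -/

section Hilbert

open scoped ENNReal

variable {ι H : Type*} [NormedAddCommGroup H] [InnerProductSpace ℂ H]

/-- The balls of radius `1 / 2` around the vectors of an orthonormal system are disjoint. -/
theorem countable_of_hilbertBasis [TopologicalSpace.SeparableSpace H] (b : HilbertBasis ι ℂ H) :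
    Countable ι := by
  refine Pairwise.countable_of_isOpen_disjoint (s := fun i => Metric.ball (b i) (1 / 2)) ?_
    (fun _ => Metric.isOpen_ball) (fun i => ⟨b i, Metric.mem_ball_self (by norm_num)⟩)
  intro i j hij
  refine Metric.ball_disjoint_ball ?_
  have h0 : inner ℂ (b i) (b j) = 0 := b.orthonormal.2 hij
  have h : ‖b i - b j‖ ^ 2 = 2 := by
    rw [@norm_sub_sq ℂ, h0, b.orthonormal.1 i, b.orthonormal.1 j]
    norm_num
  rw [dist_eq_norm]
  nlinarith [norm_nonneg (b i - b j)]

/-- Parseval's identity. -/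
theorem tsum_enorm_inner_sq (b : HilbertBasis ι ℂ H) (x : H) :
    ∑' i, ‖(inner ℂ (b i) x : ℂ)‖ₑ ^ 2 = ‖x‖ₑ ^ 2 := by
  have h := b.hasSum_inner_mul_inner x x
  have h2 : HasSum (fun i => ‖(inner ℂ (b i) x : ℂ)‖ ^ 2) (‖x‖ ^ 2) := by
    have h3 := Complex.hasSum_re h
    convert! h3 using 1
    · ext i
      rw [← inner_conj_symm x (b i), ← Complex.normSq_eq_conj_mul_self, Complex.ofReal_re,
        Complex.normSq_eq_norm_sq]
    · rw [inner_self_eq_norm_sq_to_K]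
      norm_cast
  rw [← ofReal_norm, ← ENNReal.ofReal_pow (norm_nonneg _), ← h2.tsum_eq,
    ENNReal.ofReal_tsum_of_nonneg (fun _ => by positivity) h2.summable]
  refine tsum_congr fun i => ?_
  rw [ENNReal.ofReal_pow (norm_nonneg _), ofReal_norm]

end Hilbert

section Coherent

open scoped ENNReal

variable {p : ℕ} {T : ℝ}

/-- The standard unit vectors of `ℂ^p`. -/
abbrev stdVec (a : Fin p) : EuclideanSpace ℂ (Fin p) := EuclideanSpace.single a 1

theorem sum_enorm_inner_stdVec_sq (w : EuclideanSpace ℂ (Fin p)) :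
    ∑ a, ‖(inner ℂ (stdVec a) w : ℂ)‖ₑ ^ 2 = ‖w‖ₑ ^ 2 := by
  rw [← ofReal_norm, ← ENNReal.ofReal_pow (norm_nonneg _), EuclideanSpace.norm_sq_eq,
    ENNReal.ofReal_sum_of_nonneg (fun _ _ => by positivity)]
  refine Finset.sum_congr rfl fun a _ => ?_
  rw [EuclideanSpace.inner_single_left, ENNReal.ofReal_pow (norm_nonneg _), ofReal_norm]
  simp

theorem separableSpace_L2 : TopologicalSpace.SeparableSpace (L2 p T) := by
  have : Fact ((2 : ℝ≥0∞) ≠ ∞) := ⟨by norm_num⟩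
  infer_instance

/-- The plane waves form a continuous resolution of the identity, so that the squared
Hilbert–Schmidt norm of a self-adjoint operator can be computed from them. -/
theorem tsum_enorm_sq_eq_lintegral_planeWave {ι : Type*} (b : HilbertBasis ι ℂ (L2 p T))
    {Y : L2 p T →L[ℂ] L2 p T} (hY : IsSelfAdjoint Y) :
    ∑' i, ‖Y (b i)‖ₑ ^ 2 = ∫⁻ ξ, ∑ a, ‖Y (planeWave T ξ (stdVec a))‖ₑ ^ 2 := by
  have := separableSpace_L2 (p := p) (T := T)
  have : Countable ι := countable_of_hilbertBasis b
  have h1 : ∀ ξ, ∑ a, ‖Y (planeWave T ξ (stdVec a))‖ₑ ^ 2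
      = ∑' i, ‖boxFourier (Y (b i)) ξ‖ₑ ^ 2 := by
    intro ξ
    simp only [← tsum_enorm_inner_sq b (Y _), ← sum_enorm_inner_stdVec_sq (boxFourier _ _)]
    rw [← Summable.tsum_finsetSum (fun _ _ => ENNReal.summable)]
    refine tsum_congr fun i => Finset.sum_congr rfl fun a _ => ?_
    rw [← inner_planeWave, ← hY.adjoint_eq, ContinuousLinearMap.adjoint_inner_right, hY.adjoint_eq,
      ← inner_conj_symm, RCLike.enorm_conj]
  simp only [h1]
  rw [lintegral_tsum fun i => ((continuous_boxFourier _).enorm.measurable.pow_const 2).aemeasurable]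
  exact tsum_congr fun i => (lintegral_boxFourier_sq _).symm

end Coherent

/-! ### Traces of positive operators -/

section Positive

open scoped ENNReal

variable {H : Type*} [NormedAddCommGroup H] [InnerProductSpace ℂ H] [CompleteSpace H]

theorem exists_isSelfAdjoint_mul_self_eq {X : H →L[ℂ] H} (hX : 0 ≤ X) :
    ∃ Y : H →L[ℂ] H, IsSelfAdjoint Y ∧ Y * Y = X :=
  ⟨CFC.sqrt X, (CFC.sqrt_nonneg X).isSelfAdjoint, CFC.sqrt_mul_sqrt_self X hX⟩

/-- Powers of positive operators are squares, so that their diagonal matrix elements are squared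
norms. -/
theorem exists_isSelfAdjoint_mul_self_eq_pow {X : H →L[ℂ] H} (hX : 0 ≤ X) (n : ℕ) :
    ∃ Y : H →L[ℂ] H, IsSelfAdjoint Y ∧ Y * Y = X ^ n :=
  exists_isSelfAdjoint_mul_self_eq (CStarAlgebra.pow_nonneg hX n)

theorem inner_mul_self_apply {Y : H →L[ℂ] H} (hY : IsSelfAdjoint Y) (x : H) :
    inner ℂ x ((Y * Y) x) = ((‖Y x‖ ^ 2 : ℝ) : ℂ) := by
  rw [mul_apply_eq_comp, ← ContinuousLinearMap.adjoint_inner_left, hY.adjoint_eq,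
    inner_self_eq_norm_sq_to_K]
  norm_cast

/-- As `X ^ (n + 1) = √X X ^ n √X`, its diagonal matrix elements are at most `‖X‖ ^ n` times those
of `X`. -/
theorem norm_inner_pow_succ_le {X : H →L[ℂ] H} (hX : 0 ≤ X) {M : ℝ} (hM : ‖X‖ ≤ M) (n : ℕ)
    (x : H) : ‖(inner ℂ x ((X ^ (n + 1)) x) : ℂ)‖ ≤ M ^ n * (inner ℂ x (X x)).re := by
  obtain ⟨Y, hs, hYX⟩ := exists_isSelfAdjoint_mul_self_eq hX
  have h1 : X ^ (n + 1) = Y * (X ^ n * Y) := by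
    have hc : Commute Y X := by rw [← hYX]; exact (Commute.refl Y).mul_right (Commute.refl Y)
    rw [← (hc.pow_right n).eq, ← mul_assoc, hYX, pow_succ']
  rw [h1, mul_apply_eq_comp, ← ContinuousLinearMap.adjoint_inner_left, hs.adjoint_eq,
    ← hYX, inner_mul_self_apply hs, Complex.ofReal_re, hYX, mul_apply_eq_comp]
  have hMn : ‖X ^ n‖ ≤ M ^ n := by
    rcases n.eq_zero_or_pos with rfl | hn
    · rw [pow_zero, pow_zero]
      exact ContinuousLinearMap.norm_id_le
    · exact (norm_pow_le' X hn).trans (pow_le_pow_left₀ (norm_nonneg _) hM n)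
  calc _ ≤ ‖Y x‖ * (‖X ^ n‖ * ‖Y x‖) :=
        (norm_inner_le_norm _ _).trans (by gcongr; exact ContinuousLinearMap.le_opNorm _ _)
    _ ≤ ‖Y x‖ * (M ^ n * ‖Y x‖) := by gcongr
    _ = _ := by ring

end Positive

section CoherentTrace

open scoped ENNReal

variable {p : ℕ} {T : ℝ}

/-- The trace of a positive operator `Y²` is the integral of its diagonal matrix elements in the plane
waves. -/
theorem hasSum_inner_mul_self {ι : Type*} (b : HilbertBasis ι ℂ (L2 p T)) (hT : 0 ≤ T)
    {Y : L2 p T →L[ℂ] L2 p T} (hs : IsSelfAdjoint Y)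
    (hfin : ∫⁻ ξ, ∑ a, ‖Y (planeWave T ξ (stdVec a))‖ₑ ^ 2 ≠ ∞) :
    Integrable (fun ξ => ∑ a, inner ℂ (planeWave T ξ (stdVec a)) ((Y * Y) (planeWave T ξ (stdVec a)))) ∧
    HasSum (fun i => inner ℂ (b i) ((Y * Y) (b i)))
      (∫ ξ, ∑ a, inner ℂ (planeWave T ξ (stdVec a)) ((Y * Y) (planeWave T ξ (stdVec a)))) := by
  have hsum := tsum_enorm_sq_eq_lintegral_planeWave b hs
  set G : ℝ → ℝ := fun ξ => ∑ a, ‖Y (planeWave T ξ (stdVec a))‖ ^ 2 with hG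
  have hGe : ∀ ξ, ENNReal.ofReal (G ξ)
      = ∑ a, ‖Y (planeWave T ξ (stdVec a))‖ₑ ^ 2 := fun ξ => by
    rw [hG, ENNReal.ofReal_sum_of_nonneg (fun _ _ => by positivity)]
    exact Finset.sum_congr rfl fun a _ => by
      rw [ENNReal.ofReal_pow (norm_nonneg _), ofReal_norm]
  have hGc : Continuous G := continuous_finsetSum _ fun a _ =>
    (((Y).continuous.comp (continuous_planeWave hT (stdVec a))).norm.pow 2)
  have hG0 : ∀ ξ, 0 ≤ G ξ := fun ξ => Finset.sum_nonneg fun _ _ => by positivity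
  have hGi : Integrable G := by
    refine ⟨hGc.aestronglyMeasurable, ?_⟩
    rw [hasFiniteIntegral_iff_ofReal (ae_of_all _ hG0)]
    simp only [hGe]
    exact hfin.lt_top
  have e1 : ∀ ξ, ∑ a, inner ℂ (planeWave T ξ (stdVec a)) ((Y * Y) (planeWave T ξ (stdVec a)))
      = ((G ξ : ℝ) : ℂ) := fun ξ => by
    simp only [inner_mul_self_apply hs, hG]
    push_cast
    rfl
  simp only [e1]
  simp only [inner_mul_self_apply hs]
  refine ⟨hGi.ofReal, ?_⟩
  rw [integral_complex_ofReal]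
  refine Complex.hasSum_ofReal.2 ?_
  have e2 : ∑' i, ENNReal.ofReal (‖Y (b i)‖ ^ 2) = ENNReal.ofReal (∫ ξ, G ξ) := by
    rw [ofReal_integral_eq_lintegral_ofReal hGi (ae_of_all _ hG0)]
    simp only [hGe, ← hsum]
    exact tsum_congr fun i => by rw [ENNReal.ofReal_pow (norm_nonneg _), ofReal_norm]
  have e3 : Summable fun i => ‖Y (b i)‖ ^ 2 := by
    have := ENNReal.summable_toReal (f := fun i => ENNReal.ofReal (‖Y (b i)‖ ^ 2))
      (by rw [e2]; exact ENNReal.ofReal_ne_top)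
    simpa [ENNReal.toReal_ofReal, sq_nonneg] using this
  rw [← ENNReal.ofReal_tsum_of_nonneg (fun _ => by positivity) e3] at e2
  rw [← (ENNReal.ofReal_eq_ofReal_iff (tsum_nonneg fun _ => by positivity)
    (integral_nonneg hG0)).1 e2]
  exact e3.hasSum

end CoherentTrace

/-! ### Toeplitz operators -/

section Toeplitz

open scoped ENNReal NNReal

/-- `S` is an integrable function with values in the nonnegative operators on `ℂ^p`, essentially
bounded by `M`: the spectral density of a stationary process. -/
structure IsSymbol {p : ℕ} (S : ℝ → EuclideanSpace ℂ (Fin p) →L[ℂ] EuclideanSpace ℂ (Fin p))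
    (M : ℝ≥0) : Prop where
  integrable : Integrable S
  nonneg : ∀ ξ, 0 ≤ S ξ
  enorm_le : ∀ᵐ ξ, ‖S ξ‖ₑ ≤ M

/-- `K` is the truncation to `[0, T]` of the translation invariant operator with symbol `S`, that
is, of the operator that multiplies Fourier transforms by `S`. -/
def IsToeplitz {p : ℕ} (T : ℝ)
    (S : ℝ → EuclideanSpace ℂ (Fin p) →L[ℂ] EuclideanSpace ℂ (Fin p))
    (K : L2 p T →L[ℂ] L2 p T) : Prop :=
  ∀ ψ χ : L2 p T, inner ℂ ψ (K χ) = ∫ ξ, inner ℂ (boxFourier ψ ξ) (S ξ (boxFourier χ ξ))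

section L2facts

variable {α V : Type*} [MeasurableSpace α] {μ : Measure α} [NormedAddCommGroup V]

theorem enorm_toLp_sq {g : α → V} (hg : MemLp g 2 μ) :
    ‖hg.toLp g‖ₑ ^ 2 = ∫⁻ x, ‖g x‖ₑ ^ 2 ∂μ := by
  have h := eLpNorm_nnreal_pow_eq_lintegral (f := g) (μ := μ) (p := 2) (by norm_num)
  rw [Lp.enorm_toLp]
  simp only [NNReal.coe_ofNat, ENNReal.rpow_ofNat, ENNReal.coe_ofNat] at h
  exact h

theorem integrable_inner_of_memLp [InnerProductSpace ℂ V] {g h : α → V} (hg : MemLp g 2 μ)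
    (hh : MemLp h 2 μ) : Integrable (fun x => inner ℂ (g x) (h x)) μ := by
  refine (L2.integrable_inner (𝕜 := ℂ) (hg.toLp g) (hh.toLp h)).congr ?_
  filter_upwards [hg.coeFn_toLp, hh.coeFn_toLp] with x hx hy
  rw [hx, hy]

theorem enorm_inner_le [InnerProductSpace ℂ V] (x y : V) :
    ‖(inner ℂ x y : ℂ)‖ₑ ≤ ‖x‖ₑ * ‖y‖ₑ := by
  have := nnnorm_inner_le_nnnorm (𝕜 := ℂ) x y
  simp only [enorm_eq_nnnorm]
  exact_mod_cast this

/-- The Cauchy-Schwarz inequality in `L²`. -/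
theorem enorm_integral_inner_sq_le [InnerProductSpace ℂ V] {g h : α → V} (hg : MemLp g 2 μ)
    (hh : MemLp h 2 μ) :
    ‖∫ x, inner ℂ (g x) (h x) ∂μ‖ₑ ^ 2 ≤ (∫⁻ x, ‖g x‖ₑ ^ 2 ∂μ) * ∫⁻ x, ‖h x‖ₑ ^ 2 ∂μ := by
  have e : ∫ x, inner ℂ (g x) (h x) ∂μ = inner ℂ (hg.toLp g) (hh.toLp h) := by
    rw [L2.inner_def]
    refine integral_congr_ae ?_
    filter_upwards [hg.coeFn_toLp, hh.coeFn_toLp] with x hx hy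
    rw [hx, hy]
  rw [e, ← enorm_toLp_sq hg, ← enorm_toLp_sq hh, ← mul_pow]
  exact pow_le_pow_left' (enorm_inner_le _ _) 2

end L2facts

variable {p : ℕ} {T : ℝ} {S : ℝ → EuclideanSpace ℂ (Fin p) →L[ℂ] EuclideanSpace ℂ (Fin p)}
  {M : ℝ≥0} {K : L2 p T →L[ℂ] L2 p T}

theorem IsSymbol.norm_le (hS : IsSymbol S M) : ∀ᵐ ξ, ‖S ξ‖ ≤ M :=
  hS.enorm_le.mono fun ξ h => by
    rw [enorm_eq_nnnorm] at h
    exact_mod_cast h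

theorem IsSymbol.memLp_two (hS : IsSymbol S M) : MemLp S 2 := by
  rw [memLp_two_iff_integrable_sq_norm hS.integrable.1]
  refine (hS.integrable.norm.const_mul M).mono' (hS.integrable.1.norm.pow 2)
    (hS.norm_le.mono fun ξ h => ?_)
  rw [Real.norm_of_nonneg (by positivity), sq]
  exact mul_le_mul_of_nonneg_right h (norm_nonneg _)

theorem IsSymbol.aestronglyMeasurable_apply (hS : IsSymbol S M) {g : ℝ → EuclideanSpace ℂ (Fin p)}
    (hg : AEStronglyMeasurable g) : AEStronglyMeasurable (fun ξ => S ξ (g ξ)) :=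
  (ContinuousLinearMap.apply ℂ (EuclideanSpace ℂ (Fin p))).aestronglyMeasurable_comp₂
    hg hS.integrable.1

theorem IsSymbol.memLp_apply (hS : IsSymbol S M) {g : ℝ → EuclideanSpace ℂ (Fin p)}
    (hg : MemLp g 2) : MemLp (fun ξ => S ξ (g ξ)) 2 := by
  refine hg.of_le_mul (c := M) (hS.aestronglyMeasurable_apply hg.1) (hS.norm_le.mono fun ξ h => ?_)
  exact (S ξ).le_of_opNorm_le h _

theorem IsToeplitz.enorm_apply_le (hS : IsSymbol S M) (hK : IsToeplitz T S K) (χ : L2 p T) :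
    ‖K χ‖ₑ ≤ M * ‖χ‖ₑ := by
  -- Test against `K χ` and cancel one factor `‖K χ‖`.
  rcases eq_or_ne ‖K χ‖ₑ 0 with h0 | h0
  · rw [h0]; exact zero_le
  have h1 := enorm_integral_inner_sq_le (memLp_boxFourier (K χ))
    (hS.memLp_apply (memLp_boxFourier χ))
  rw [← hK, lintegral_boxFourier_sq] at h1
  have h2 : ∫⁻ ξ, ‖S ξ (boxFourier χ ξ)‖ₑ ^ 2 ≤ (M * ‖χ‖ₑ) ^ 2 := by
    rw [mul_pow, ← lintegral_boxFourier_sq, ← lintegral_const_mul _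
      ((continuous_boxFourier _).enorm.measurable.pow_const 2)]
    refine lintegral_mono_ae (hS.enorm_le.mono fun ξ h => ?_)
    rw [← mul_pow]
    exact pow_le_pow_left' (((S ξ).le_opENorm _).trans (by gcongr)) 2
  have h3 : ‖(inner ℂ (K χ) (K χ) : ℂ)‖ₑ = ‖K χ‖ₑ * ‖K χ‖ₑ := by
    rw [inner_self_eq_norm_sq_to_K, enorm_pow, sq, ← ofReal_norm, ← ofReal_norm (K χ)]
    simp
  rw [h3] at h1
  have h4 := h1.trans (mul_le_mul_right h2 _)
  rw [← mul_pow] at h4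
  have h5 : ‖K χ‖ₑ * ‖K χ‖ₑ ≤ ‖K χ‖ₑ * (M * ‖χ‖ₑ) :=
    (ENNReal.pow_le_pow_left_iff two_ne_zero).1 h4
  exact (ENNReal.mul_le_mul_iff_right h0 enorm_ne_top).1 h5

theorem IsToeplitz.norm_le (hS : IsSymbol S M) (hK : IsToeplitz T S K) : ‖K‖ ≤ M :=
  K.opNorm_le_bound M.2 fun χ => by
    have := hK.enorm_apply_le hS χ
    simp only [enorm_eq_nnnorm] at this
    exact_mod_cast this

theorem inner_apply_re_nonneg {H : Type*} [NormedAddCommGroup H] [InnerProductSpace ℂ H]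
    {X : H →L[ℂ] H} (hX : 0 ≤ X) (v : H) : 0 ≤ (inner ℂ v (X v)).re :=
  ((ContinuousLinearMap.nonneg_iff_isPositive X).1 hX).re_inner_nonneg_right v

theorem inner_apply_eq_ofReal {H : Type*} [NormedAddCommGroup H] [InnerProductSpace ℂ H]
    {X : H →L[ℂ] H} (hX : 0 ≤ X) (v : H) :
    inner ℂ v (X v) = (((inner ℂ v (X v) : ℂ).re : ℝ) : ℂ) := by
  have h := ((ContinuousLinearMap.nonneg_iff_isPositive X).1 hX).inner_nonneg_right v
  exact Complex.ext rfl (by rw [Complex.ofReal_im]; exact (Complex.nonneg_iff.1 h).2.symm)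

theorem IsToeplitz.nonneg (hS : IsSymbol S M) (hK : IsToeplitz T S K) : 0 ≤ K := by
  rw [ContinuousLinearMap.nonneg_iff_isPositive, ContinuousLinearMap.isPositive_iff_complex]
  intro χ
  have e : inner ℂ χ (K χ) = ((∫ ξ, (inner ℂ (boxFourier χ ξ) (S ξ (boxFourier χ ξ))).re : ℝ) : ℂ) := by
    rw [hK, ← integral_complex_ofReal]
    exact integral_congr_ae (ae_of_all _ fun ξ => inner_apply_eq_ofReal (hS.nonneg ξ) _)
  have e2 : inner ℂ (K χ) χ
      = ((∫ ξ, (inner ℂ (boxFourier χ ξ) (S ξ (boxFourier χ ξ))).re : ℝ) : ℂ) := by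
    rw [← inner_conj_symm, e, Complex.conj_ofReal]
  rw [e2]
  refine ⟨by simp, ?_⟩
  simpa using integral_nonneg fun ξ => inner_apply_re_nonneg (hS.nonneg ξ) _

theorem memLp_dirichletKernel_smul (ξ : ℝ) (v : EuclideanSpace ℂ (Fin p)) :
    MemLp (fun η => dirichletKernel T (ξ - η) • v) 2 := by
  have := memLp_boxFourier (planeWave T ξ v)
  rwa [show boxFourier (planeWave T ξ v) = _ from funext fun η => boxFourier_planeWave ξ η v]
    at this

/-- The mean square oscillation of the symbol near the frequency `ξ`, weighted by the squared
Dirichlet kernel. -/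
def oscillation (T : ℝ) (S : ℝ → EuclideanSpace ℂ (Fin p) →L[ℂ] EuclideanSpace ℂ (Fin p))
    (ξ : ℝ) : ℝ≥0∞ :=
  ∫⁻ η, ‖dirichletKernel T (ξ - η)‖ₑ ^ 2 * ‖S η - S ξ‖ₑ ^ 2

/-- Plane waves are approximate eigenvectors: the defect is controlled by the oscillation of the
symbol. -/
theorem IsToeplitz.enorm_planeWave_sub_le (hS : IsSymbol S M)
    (hK : IsToeplitz T S K) (ξ : ℝ) (v : EuclideanSpace ℂ (Fin p)) :
    ‖K (planeWave T ξ v) - planeWave T ξ (S ξ v)‖ₑ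
      ≤ ‖v‖ₑ * oscillation T S ξ ^ (1 / 2 : ℝ) := by
  set R := K (planeWave T ξ v) - planeWave T ξ (S ξ v) with hR
  have m1 : MemLp (fun η => S η (dirichletKernel T (ξ - η) • v)) 2 :=
    hS.memLp_apply (memLp_dirichletKernel_smul ξ v)
  have m2 : MemLp (fun η => dirichletKernel T (ξ - η) • S ξ v) 2 :=
    memLp_dirichletKernel_smul ξ (S ξ v)
  -- Both vectors in the defect `R` are projections of functions on the whole frequency axis, so
  -- `‖R‖²` is the inner product of `R̂` with the difference of these functions.
  have e : inner ℂ R R = ∫ η, inner ℂ (boxFourier R η)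
      (S η (dirichletKernel T (ξ - η) • v) - dirichletKernel T (ξ - η) • S ξ v) := by
    conv_lhs => rw [hR, inner_sub_right, hK, ← integral_inner_boxFourier, ← hR]
    simp only [boxFourier_planeWave]
    rw [← integral_sub (integrable_inner_of_memLp (memLp_boxFourier R) m1)
      (integrable_inner_of_memLp (memLp_boxFourier R) m2)]
    simp only [inner_sub_right]
  have h1 := enorm_integral_inner_sq_le (memLp_boxFourier R) (m1.sub m2)
  simp only [Pi.sub_apply] at h1
  rw [← e, lintegral_boxFourier_sq] at h1
  have h2 : ∫⁻ η, ‖S η (dirichletKernel T (ξ - η) • v) - dirichletKernel T (ξ - η) • S ξ v‖ₑ ^ 2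
      ≤ ‖v‖ₑ ^ 2 * oscillation T S ξ := by
    rw [oscillation, ← lintegral_const_mul' _ _ (by simp)]
    refine lintegral_mono fun η => ?_
    rw [map_smul, ← smul_sub, ← sub_apply, enorm_smul, mul_pow, mul_left_comm]
    gcongr
    rw [← mul_pow, mul_comm]
    gcongr
    exact ContinuousLinearMap.le_opENorm _ _
  rcases eq_or_ne ‖R‖ₑ 0 with h0 | h0
  · rw [h0]; exact zero_le
  have h3 : ‖(inner ℂ R R : ℂ)‖ₑ = ‖R‖ₑ * ‖R‖ₑ := by
    rw [inner_self_eq_norm_sq_to_K, enorm_pow, sq, ← ofReal_norm, ← ofReal_norm R]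
    simp
  have h4 := h1.trans (mul_le_mul_right h2 _)
  have h6 : ‖v‖ₑ ^ 2 * oscillation T S ξ = (‖v‖ₑ * oscillation T S ξ ^ (1 / 2 : ℝ)) ^ 2 := by
    rw [mul_pow, ← ENNReal.rpow_natCast (_ ^ (1 / 2 : ℝ)), ← ENNReal.rpow_mul]
    norm_num
  rw [h3, h6, ← mul_pow] at h4
  have h5 := (ENNReal.pow_le_pow_left_iff two_ne_zero).1 h4
  exact (ENNReal.mul_le_mul_iff_right h0 enorm_ne_top).1 h5

end Toeplitz

/-! ### The mean oscillation of the symbol -/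

section Oscillation

open scoped ENNReal NNReal

variable {p : ℕ} {T : ℝ} {S : ℝ → EuclideanSpace ℂ (Fin p) →L[ℂ] EuclideanSpace ℂ (Fin p)}
  {M : ℝ≥0}

/-- The squared `L²`-distance between the symbol and its translate by `u`. -/
def translationDefect (S : ℝ → EuclideanSpace ℂ (Fin p) →L[ℂ] EuclideanSpace ℂ (Fin p))
    (u : ℝ) : ℝ≥0∞ :=
  ∫⁻ ξ, ‖S (ξ - u) - S ξ‖ₑ ^ 2

theorem translationDefect_zero : translationDefect S 0 = 0 := by
  simp only [translationDefect, sub_zero, sub_self, enorm_eq_nnnorm, nnnorm_zero]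
  simp

/-- Translations are strongly continuous on `L²`. -/
theorem continuous_translationDefect (h : MemLp S 2) : Continuous (translationDefect S) := by
  let g : ℝ → C(ℝ, ℝ) := fun u => ⟨fun ξ => ξ - u, by fun_prop⟩
  have hg : Continuous g := ContinuousMap.continuous_of_continuous_uncurry _ (by
    show Continuous fun z : ℝ × ℝ => z.2 - z.1
    fun_prop)
  have hgm : ∀ u, MeasurePreserving (g u) volume volume := fun u =>
    measurePreserving_sub_right volume u
  have hc := (continuous_const (y := h.toLp S)).compMeasurePreservingLp hg hgm (by norm_num)
  have e : ∀ u, translationDefect S u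
      = ‖Lp.compMeasurePreserving (g u) (hgm u) (h.toLp S) - h.toLp S‖ₑ ^ 2 := by
    intro u
    rw [Lp.toLp_compMeasurePreserving, ← MemLp.toLp_sub, enorm_toLp_sq]
    rfl
  rw [funext e]
  exact (ENNReal.continuous_pow 2).comp (hc.sub continuous_const).enorm

/-- The bound `‖x - y‖² ≤ 2 ‖x‖² + 2 ‖y‖²`, which supplies a dominating function that does not
depend on the translation. -/
theorem translationDefect_le (h : MemLp S 2) (u : ℝ) :
    translationDefect S u ≤ 4 * ∫⁻ ξ, ‖S ξ‖ₑ ^ 2 := by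
  have h1 : translationDefect S u ≤ ∫⁻ ξ, (2 * ‖S (ξ - u)‖ₑ ^ 2 + 2 * ‖S ξ‖ₑ ^ 2) := by
    refine lintegral_mono fun ξ => ?_
    simp only [enorm_eq_nnnorm]
    norm_cast
    rw [← NNReal.coe_le_coe]
    push_cast
    have := norm_sub_le (S (ξ - u)) (S ξ)
    nlinarith [sq_nonneg (‖S (ξ - u)‖ - ‖S ξ‖), norm_nonneg (S (ξ - u) - S ξ)]
  refine h1.trans (le_of_eq ?_)
  rw [lintegral_add_right' _ ((h.1.enorm.pow_const 2).const_mul 2),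
    lintegral_const_mul' _ _ (by norm_num), lintegral_const_mul' _ _ (by norm_num),
    lintegral_sub_right_eq_self (fun ξ => ‖S ξ‖ₑ ^ 2) u, ← add_mul]
  norm_num

theorem aemeasurable_oscillation_kernel (h : AEStronglyMeasurable S) (T : ℝ) :
    AEMeasurable (fun z : ℝ × ℝ => ‖dirichletKernel T z.2‖ₑ ^ 2 * ‖S (z.1 - z.2) - S z.1‖ₑ ^ 2)
      ((volume : Measure ℝ).prod volume) := by
  have h1 : AEMeasurable (fun z : ℝ × ℝ => ‖dirichletKernel T z.2‖ₑ ^ 2)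
      ((volume : Measure ℝ).prod volume) :=
    (((continuous_dirichletKernel T).comp continuous_snd).enorm.measurable.pow_const 2).aemeasurable
  have h2 : AEStronglyMeasurable (fun z : ℝ × ℝ => S (z.1 - z.2) - S z.1)
      ((volume : Measure ℝ).prod volume) :=
    (h.comp_quasiMeasurePreserving (quasiMeasurePreserving_sub volume volume)).sub h.comp_fst
  exact h1.mul (h2.enorm.pow_const 2)

theorem oscillation_eq (T ξ : ℝ) :
    oscillation T S ξ = ∫⁻ u, ‖dirichletKernel T u‖ₑ ^ 2 * ‖S (ξ - u) - S ξ‖ₑ ^ 2 := by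
  rw [← lintegral_sub_left_eq_self _ ξ]
  simp only [sub_sub_cancel]
  rfl

theorem aemeasurable_oscillation (h : AEStronglyMeasurable S) (T : ℝ) :
    AEMeasurable (oscillation T S) := by
  rw [funext (oscillation_eq T)]
  exact (aemeasurable_oscillation_kernel h T).lintegral_prod_right'

theorem lintegral_comp_div {T : ℝ} (hT : 0 < T) (h : ℝ → ℝ≥0∞) :
    ∫⁻ u, h u = ENNReal.ofReal T⁻¹ * ∫⁻ v, h (v / T) := by
  have e := Real.map_volume_mul_left (a := T) hT.ne'
  have e2 : ∫⁻ v, h (v / T) ∂(Measure.map (fun x => T * x) volume) = ∫⁻ u, h u := by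
    refine ((Homeomorph.mulLeft₀ T hT.ne').measurableEmbedding.lintegral_map (μ := volume)
      (fun v => h (v / T))).trans (lintegral_congr fun u => ?_)
    show h (T * u / T) = h u
    rw [mul_div_cancel_left₀ _ hT.ne']
  rw [← e2, e, lintegral_smul_measure, abs_of_pos (inv_pos.2 hT), smul_eq_mul]

/-- Fubini's theorem and the substitution `u = v / T` in the Dirichlet kernel, whose square
concentrates at `0`. -/
theorem lintegral_oscillation (hT : 0 < T) (h : MemLp S 2) :
    ∫⁻ ξ, oscillation T S ξ = ENNReal.ofReal T *
      ∫⁻ v, ‖dirichletKernel 1 v‖ₑ ^ 2 * translationDefect S (v / T) := by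
  simp only [oscillation_eq]
  rw [lintegral_lintegral_swap (aemeasurable_oscillation_kernel h.1 T)]
  have e1 : ∀ u, ∫⁻ ξ, ‖dirichletKernel T u‖ₑ ^ 2 * ‖S (ξ - u) - S ξ‖ₑ ^ 2
      = ‖dirichletKernel T u‖ₑ ^ 2 * translationDefect S u := fun u => by
    rw [lintegral_const_mul' _ _ (by simp), translationDefect]
  simp only [e1]
  rw [lintegral_comp_div hT]
  have e2 : ∀ v, ‖dirichletKernel T (v / T)‖ₑ ^ 2 * translationDefect S (v / T)
      = ENNReal.ofReal (T ^ 2) * (‖dirichletKernel 1 v‖ₑ ^ 2 * translationDefect S (v / T)) := by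
    intro v
    rw [dirichletKernel_mul hT, mul_div_cancel₀ _ hT.ne', enorm_mul, mul_pow, mul_assoc,
      ← ofReal_norm (T : ℂ), ← ENNReal.ofReal_pow (norm_nonneg _), Complex.norm_real,
      Real.norm_of_nonneg hT.le]
  simp only [e2]
  rw [lintegral_const_mul' _ _ ENNReal.ofReal_ne_top, ← mul_assoc,
    ← ENNReal.ofReal_mul (inv_nonneg.2 hT.le)]
  congr 2
  field_simp

/-- The mean oscillation of the symbol, per unit of time, vanishes in the limit of long
observation. -/
theorem tendsto_lintegral_oscillation_div (h : MemLp S 2) :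
    Tendsto (fun T : ℝ => (∫⁻ ξ, oscillation T S ξ) / ENNReal.ofReal T) atTop (𝓝 0) := by
  have h2 : ∫⁻ ξ, ‖S ξ‖ₑ ^ 2 ≠ ∞ := by
    rw [lintegral_enorm_sq_eq_ofReal h]
    exact ENNReal.ofReal_ne_top
  have key : Tendsto (fun T : ℝ => ∫⁻ v, ‖dirichletKernel 1 v‖ₑ ^ 2 * translationDefect S (v / T))
      atTop (𝓝 (∫⁻ _ : ℝ, 0)) := by
    refine tendsto_lintegral_filter_of_dominated_convergence
      (fun v => ‖dirichletKernel 1 v‖ₑ ^ 2 * (4 * ∫⁻ ξ, ‖S ξ‖ₑ ^ 2)) ?_ ?_ ?_ ?_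
    · refine Eventually.of_forall fun T => Measurable.mul ?_ ?_
      · exact (continuous_dirichletKernel 1).enorm.measurable.pow_const 2
      · exact ((continuous_translationDefect h).comp (continuous_id.div_const T)).measurable
    · exact Eventually.of_forall fun T => ae_of_all _ fun v => by
        gcongr
        exact translationDefect_le h _
    · rw [lintegral_mul_const _ ((continuous_dirichletKernel 1).enorm.measurable.pow_const 2),
        lintegral_dirichletKernel_sq zero_le_one]
      exact ENNReal.mul_ne_top ENNReal.ofReal_ne_top (ENNReal.mul_ne_top (by norm_num) h2)
    · refine ae_of_all _ fun v => ?_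
      have h3 : Tendsto (fun T : ℝ => v / T) atTop (𝓝 0) := tendsto_const_nhds.div_atTop tendsto_id
      have h4 := ((continuous_translationDefect h).tendsto 0).comp h3
      rw [translationDefect_zero] at h4
      have h5 := ENNReal.Tendsto.const_mul (a := ‖dirichletKernel 1 v‖ₑ ^ 2) h4 (Or.inr (by simp))
      rwa [mul_zero] at h5
  rw [lintegral_zero] at key
  refine key.congr' ((eventually_gt_atTop 0).mono fun T hT => ?_)
  beta_reduce
  rw [lintegral_oscillation hT h, mul_comm, mul_div_assoc,
    ENNReal.div_self (ENNReal.ofReal_pos.2 hT).ne' ENNReal.ofReal_ne_top, mul_one]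

end Oscillation

/-! ### Traces of powers of Toeplitz operators -/

section Powers

open scoped ENNReal NNReal

variable {p : ℕ} {T : ℝ} {S : ℝ → EuclideanSpace ℂ (Fin p) →L[ℂ] EuclideanSpace ℂ (Fin p)}
  {M : ℝ≥0} {K : L2 p T →L[ℂ] L2 p T}

/-- The trace of an operator on `L²([0,T], ℂ^p)`, computed from the plane waves. -/
def planeWaveTrace (X : L2 p T →L[ℂ] L2 p T) : ℂ :=
  ∫ ξ, ∑ a, inner ℂ (planeWave T ξ (stdVec a)) (X (planeWave T ξ (stdVec a)))

/-- The integrated trace of the `n`-th power of a symbol. -/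
def symbolTrace (S : ℝ → EuclideanSpace ℂ (Fin p) →L[ℂ] EuclideanSpace ℂ (Fin p)) (n : ℕ) : ℂ :=
  ∫ ξ, ∑ a, inner ℂ (stdVec a) ((S ξ ^ n) (stdVec a))

/-- The diagonal matrix elements of `K` in the plane waves are those of the symbol, smeared by the
squared Dirichlet kernel, the integral of which is `T`. -/
theorem lintegral_inner_planeWave (hT : 0 ≤ T) (hS : IsSymbol S M) (hK : IsToeplitz T S K)
    (v : EuclideanSpace ℂ (Fin p)) :
    ∫⁻ ξ, ENNReal.ofReal (inner ℂ (planeWave T ξ v) (K (planeWave T ξ v))).re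
      = ENNReal.ofReal T * ∫⁻ η, ENNReal.ofReal (inner ℂ v (S η v)).re := by
  have e1 : ∀ ξ η, inner ℂ (boxFourier (planeWave T ξ v) η) (S η (boxFourier (planeWave T ξ v) η))
      = ((‖dirichletKernel T (ξ - η)‖ ^ 2 * (inner ℂ v (S η v)).re : ℝ) : ℂ) := by
    intro ξ η
    rw [boxFourier_planeWave, map_smul, inner_smul_left, inner_smul_right, ← mul_assoc,
      Complex.conj_mul', inner_apply_eq_ofReal (hS.nonneg η)]
    push_cast
    rfl
  have e2 : ∀ ξ, ENNReal.ofReal (inner ℂ (planeWave T ξ v) (K (planeWave T ξ v))).re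
      = ∫⁻ η, ‖dirichletKernel T (ξ - η)‖ₑ ^ 2 * ENNReal.ofReal (inner ℂ v (S η v)).re := by
    intro ξ
    have hi := integrable_inner_of_memLp (memLp_boxFourier (planeWave T ξ v))
      (hS.memLp_apply (memLp_boxFourier (planeWave T ξ v)))
    rw [hK]
    simp only [e1] at hi ⊢
    have hi2 : Integrable fun η => ‖dirichletKernel T (ξ - η)‖ ^ 2 * (inner ℂ v (S η v)).re := by
      simpa only [RCLike.re_to_complex, Complex.ofReal_re] using hi.re
    rw [integral_complex_ofReal, Complex.ofReal_re, ofReal_integral_eq_lintegral_ofReal hi2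
      (ae_of_all _ fun η => mul_nonneg (by positivity) (inner_apply_re_nonneg (hS.nonneg η) v))]
    refine lintegral_congr fun η => ?_
    rw [ENNReal.ofReal_mul (by positivity), ENNReal.ofReal_pow (norm_nonneg _), ofReal_norm]
  have m1 : AEMeasurable (fun η => ENNReal.ofReal (inner ℂ v (S η v)).re) :=
    (Complex.measurable_re.comp_aemeasurable
      ((hS.aestronglyMeasurable_apply aestronglyMeasurable_const).const_inner).aemeasurable
      ).ennreal_ofReal
  have m2 : AEMeasurable (fun z : ℝ × ℝ => ‖dirichletKernel T (z.1 - z.2)‖ₑ ^ 2 *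
      ENNReal.ofReal (inner ℂ v (S z.2 v)).re) ((volume : Measure ℝ).prod volume) :=
    (((continuous_dirichletKernel T).comp
      (continuous_fst.sub continuous_snd)).enorm.measurable.pow_const 2).aemeasurable.mul
      (m1.comp_snd)
  simp only [e2]
  rw [lintegral_lintegral_swap m2]
  have e3 : ∀ η, ∫⁻ ξ, ‖dirichletKernel T (ξ - η)‖ₑ ^ 2 * ENNReal.ofReal (inner ℂ v (S η v)).re
      = ENNReal.ofReal T * ENNReal.ofReal (inner ℂ v (S η v)).re := by
    intro η
    rw [lintegral_mul_const' _ _ ENNReal.ofReal_ne_top,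
      lintegral_sub_right_eq_self (fun u => ‖dirichletKernel T u‖ₑ ^ 2) η,
      lintegral_dirichletKernel_sq hT]
  simp only [e3]
  rw [lintegral_const_mul' _ _ ENNReal.ofReal_ne_top]

theorem IsSymbol.integrable_inner (hS : IsSymbol S M) (v : EuclideanSpace ℂ (Fin p)) :
    Integrable fun η => (inner ℂ v (S η v) : ℂ) :=
  ((ContinuousLinearMap.apply ℂ (EuclideanSpace ℂ (Fin p)) v).integrable_comp
    hS.integrable).const_inner v

theorem lintegral_inner_planeWave_ne_top (hT : 0 ≤ T) (hS : IsSymbol S M) (hK : IsToeplitz T S K)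
    (v : EuclideanSpace ℂ (Fin p)) :
    ∫⁻ ξ, ENNReal.ofReal (inner ℂ (planeWave T ξ v) (K (planeWave T ξ v))).re ≠ ∞ := by
  rw [lintegral_inner_planeWave hT hS hK]
  exact ENNReal.mul_ne_top ENNReal.ofReal_ne_top (hS.integrable_inner v).re.lintegral_lt_top.ne

theorem enorm_sq_eq_ofReal_inner {H : Type*} [NormedAddCommGroup H] [InnerProductSpace ℂ H]
    [CompleteSpace H] {Y : H →L[ℂ] H} (hY : IsSelfAdjoint Y) (x : H) :
    ‖Y x‖ₑ ^ 2 = ENNReal.ofReal (inner ℂ x ((Y * Y) x)).re := by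
  rw [inner_mul_self_apply hY, Complex.ofReal_re, ENNReal.ofReal_pow (norm_nonneg _), ofReal_norm]

/-- Positive powers of a Toeplitz operator have a trace, which can be computed from the plane
waves. -/
theorem IsToeplitz.hasSum_inner_pow (hT : 0 ≤ T) (hS : IsSymbol S M) (hK : IsToeplitz T S K)
    (n : ℕ) :
    Integrable (fun ξ => ∑ a, inner ℂ (planeWave T ξ (stdVec a))
      ((K ^ (n + 1)) (planeWave T ξ (stdVec a)))) ∧
    ∀ {ι : Type} (b : HilbertBasis ι ℂ (L2 p T)),
      HasSum (fun i => inner ℂ (b i) ((K ^ (n + 1)) (b i))) (planeWaveTrace (K ^ (n + 1))) := by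
  have hK0 := hK.nonneg hS
  obtain ⟨Y, hY, hYK⟩ := exists_isSelfAdjoint_mul_self_eq_pow hK0 (n + 1)
  have hfin : ∫⁻ ξ, ∑ a, ‖Y (planeWave T ξ (stdVec a))‖ₑ ^ 2 ≠ ∞ := by
    have h1 : ∀ ξ, ∑ a, ‖Y (planeWave T ξ (stdVec a))‖ₑ ^ 2 ≤ ENNReal.ofReal (M ^ n) *
        ∑ a, ENNReal.ofReal (inner ℂ (planeWave T ξ (stdVec a)) (K (planeWave T ξ (stdVec a)))).re := by
      intro ξ
      rw [Finset.mul_sum]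
      refine Finset.sum_le_sum fun a _ => ?_
      rw [enorm_sq_eq_ofReal_inner hY, hYK, ← ENNReal.ofReal_mul (by positivity)]
      refine ENNReal.ofReal_le_ofReal ?_
      exact (Complex.re_le_norm _).trans (norm_inner_pow_succ_le hK0 (hK.norm_le hS) n _)
    refine ne_top_of_le_ne_top ?_ (lintegral_mono h1)
    rw [lintegral_const_mul' _ _ ENNReal.ofReal_ne_top, lintegral_finsetSum]
    · exact ENNReal.mul_ne_top ENNReal.ofReal_ne_top
        (ENNReal.sum_ne_top.2 fun a _ => lintegral_inner_planeWave_ne_top hT hS hK _)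
    · intro a _
      exact (Complex.measurable_re.comp ((continuous_planeWave hT (stdVec a)).inner
        (K.continuous.comp (continuous_planeWave hT (stdVec a)))).measurable).ennreal_ofReal
  have hb : ∀ {ι : Type} (b : HilbertBasis ι ℂ (L2 p T)), _ := fun {ι} b =>
    hasSum_inner_mul_self b hT hY hfin
  simp only [hYK] at hb
  obtain ⟨w, b, -⟩ := exists_hilbertBasis ℂ (L2 p T)
  exact ⟨(hb b).1, fun b => (hb b).2⟩

/-- For the first power there is no error term. -/
theorem planeWaveTrace_pow_one (hT : 0 ≤ T) (hS : IsSymbol S M) (hK : IsToeplitz T S K) :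
    planeWaveTrace K = T * symbolTrace S 1 := by
  have h1 : ∀ v : EuclideanSpace ℂ (Fin p),
      Integrable (fun ξ => (inner ℂ (planeWave T ξ v) (K (planeWave T ξ v)) : ℂ)) ∧
      ∫ ξ, inner ℂ (planeWave T ξ v) (K (planeWave T ξ v)) = T * ∫ η, inner ℂ v (S η v) := by
    intro v
    set g : ℝ → ℝ := fun ξ => (inner ℂ (planeWave T ξ v) (K (planeWave T ξ v)) : ℂ).re with hg
    have hc : Continuous g := Complex.continuous_re.comp ((continuous_planeWave hT v).inner
        (K.continuous.comp (continuous_planeWave hT v)))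
    have e1 : ∀ ξ, inner ℂ (planeWave T ξ v) (K (planeWave T ξ v)) = ((g ξ : ℝ) : ℂ) := fun ξ =>
      inner_apply_eq_ofReal (hK.nonneg hS) _
    have g0 : ∀ ξ, 0 ≤ g ξ := fun ξ => inner_apply_re_nonneg (hK.nonneg hS) _
    have e2 : ∀ η, inner ℂ v (S η v) = (((inner ℂ v (S η v) : ℂ).re : ℝ) : ℂ) := fun η =>
      inner_apply_eq_ofReal (hS.nonneg η) _
    have gi : Integrable g := by
      refine ⟨hc.aestronglyMeasurable, ?_⟩
      rw [hasFiniteIntegral_iff_ofReal (ae_of_all _ g0)]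
      exact (lintegral_inner_planeWave_ne_top hT hS hK v).lt_top
    simp only [e1]
    refine ⟨gi.ofReal, ?_⟩
    rw [integral_congr_ae (ae_of_all _ e2), integral_complex_ofReal, integral_complex_ofReal,
      integral_eq_lintegral_of_nonneg_ae (ae_of_all _ g0) hc.aestronglyMeasurable,
      lintegral_inner_planeWave hT hS hK, ENNReal.toReal_mul, ENNReal.toReal_ofReal hT,
      integral_eq_lintegral_of_nonneg_ae
        (ae_of_all _ fun η => inner_apply_re_nonneg (hS.nonneg η) v)
        (hS.integrable_inner v).re.1]
    push_cast
    rfl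
  simp only [planeWaveTrace, symbolTrace, pow_one]
  rw [integral_finsetSum _ fun a _ => (h1 _).1, integral_finsetSum _ fun a _ => hS.integrable_inner _,
    Finset.mul_sum]
  exact Finset.sum_congr rfl fun a _ => (h1 _).2

theorem enorm_pow_apply_le {V : Type*} [NormedAddCommGroup V] [NormedSpace ℂ V] {X : V →L[ℂ] V}
    (hX : ‖X‖ₑ ≤ M) (n : ℕ) (v : V) : ‖(X ^ n) v‖ₑ ≤ (M : ℝ≥0∞) ^ n * ‖v‖ₑ := by
  induction n with
  | zero => simp
  | succ n ih =>
    rw [pow_succ', mul_apply_eq_comp, pow_succ', mul_assoc]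
    exact (X.le_opENorm _).trans (by gcongr)

theorem enorm_planeWave (hT : 0 ≤ T) (ξ : ℝ) (v : EuclideanSpace ℂ (Fin p)) :
    ‖planeWave T ξ v‖ₑ = ENNReal.ofReal √T * ‖v‖ₑ := by
  rw [← ofReal_norm, norm_planeWave hT, ENNReal.ofReal_mul (Real.sqrt_nonneg _), ofReal_norm]

/-- Plane waves are approximate eigenvectors of the powers of `K`. The assumption `1 ≤ M` serves to
bound the lower powers of `M` by the highest one. -/
theorem enorm_pow_planeWave_sub_le (hS : IsSymbol S M) (hM : 1 ≤ M)
    (hK : IsToeplitz T S K) {ξ : ℝ} (hξ : ‖S ξ‖ₑ ≤ M) (v : EuclideanSpace ℂ (Fin p)) (n : ℕ) :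
    ‖(K ^ n) (planeWave T ξ v) - planeWave T ξ ((S ξ ^ n) v)‖ₑ
      ≤ n * (M : ℝ≥0∞) ^ n * ‖v‖ₑ * oscillation T S ξ ^ (1 / 2 : ℝ) := by
  have hM' : (1 : ℝ≥0∞) ≤ M := by exact_mod_cast hM
  induction n with
  | zero => simp
  | succ n ih =>
    have e : (K ^ (n + 1)) (planeWave T ξ v) - planeWave T ξ ((S ξ ^ (n + 1)) v)
        = K ((K ^ n) (planeWave T ξ v) - planeWave T ξ ((S ξ ^ n) v))
          + (K (planeWave T ξ ((S ξ ^ n) v)) - planeWave T ξ (S ξ ((S ξ ^ n) v))) := by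
      rw [map_sub, pow_succ', pow_succ', mul_apply_eq_comp, mul_apply_eq_comp]
      abel
    rw [e]
    refine (enorm_add_le _ _).trans ?_
    set r := oscillation T S ξ ^ (1 / 2 : ℝ)
    calc _ ≤ M * (n * (M : ℝ≥0∞) ^ n * ‖v‖ₑ * r) + (M : ℝ≥0∞) ^ n * ‖v‖ₑ * r := by
          gcongr
          · exact (hK.enorm_apply_le hS _).trans (by gcongr)
          · exact (hK.enorm_planeWave_sub_le hS ξ _).trans
              (by gcongr; exact enorm_pow_apply_le hξ n v)
      _ ≤ M * (n * (M : ℝ≥0∞) ^ n * ‖v‖ₑ * r) + (M : ℝ≥0∞) * ((M : ℝ≥0∞) ^ n * ‖v‖ₑ * r) := by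
          exact add_le_add_right (le_mul_of_one_le_left zero_le hM') _
      _ = _ := by push_cast; ring

/-- The diagonal matrix elements of powers in the plane waves. Splitting `K ^ (n + 2)` as
`K` times `K ^ (n + 1)` between the two sides of the inner product makes every error term carry
a factor `‖S ξ‖` or a second defect, which is what makes it integrable in `ξ`. -/
theorem enorm_inner_pow_planeWave_sub_le (hT : 0 ≤ T) (hS : IsSymbol S M) (hM : 1 ≤ M)
    (hK : IsToeplitz T S K) {ξ : ℝ} (hξ : ‖S ξ‖ₑ ≤ M) {v : EuclideanSpace ℂ (Fin p)}
    (hv : ‖v‖ₑ = 1) (n : ℕ) :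
    ‖inner ℂ (planeWave T ξ v) ((K ^ (n + 2)) (planeWave T ξ v))
        - T * inner ℂ v ((S ξ ^ (n + 2)) v)‖ₑ
      ≤ ((n + 2 : ℕ) * (M : ℝ≥0∞) ^ (n + 1)) *
        (ENNReal.ofReal √T * (‖S ξ‖ₑ * oscillation T S ξ ^ (1 / 2 : ℝ)) + oscillation T S ξ) := by
  have hM' : (1 : ℝ≥0∞) ≤ M := by exact_mod_cast hM
  set r := oscillation T S ξ ^ (1 / 2 : ℝ) with hr
  have hr2 : r * r = oscillation T S ξ := by
    rw [hr, ← sq, ← ENNReal.rpow_natCast, ← ENNReal.rpow_mul]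
    norm_num
  set u := planeWave T ξ v with hu
  have hKs : IsSelfAdjoint K := (hK.nonneg hS).isSelfAdjoint
  have hSs : IsSelfAdjoint (S ξ) := (hS.nonneg ξ).isSelfAdjoint
  set A := K u - planeWave T ξ (S ξ v) with hA
  set B := (K ^ (n + 1)) u - planeWave T ξ ((S ξ ^ (n + 1)) v) with hB
  have hA1 : ‖A‖ₑ ≤ r := by
    have := hK.enorm_planeWave_sub_le hS ξ v
    rwa [hv, one_mul] at this
  have hB1 : ‖B‖ₑ ≤ (n + 1 : ℕ) * (M : ℝ≥0∞) ^ (n + 1) * r := by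
    have := enorm_pow_planeWave_sub_le hS hM hK hξ v (n + 1)
    rwa [hv, mul_one] at this
  have e1 : inner ℂ u ((K ^ (n + 2)) u) = inner ℂ (K u) ((K ^ (n + 1)) u) := by
    rw [pow_succ', mul_apply_eq_comp, ← ContinuousLinearMap.adjoint_inner_left, hKs.adjoint_eq]
  have e2 : inner ℂ v ((S ξ ^ (n + 2)) v) = inner ℂ (S ξ v) ((S ξ ^ (n + 1)) v) := by
    rw [pow_succ', mul_apply_eq_comp, ← ContinuousLinearMap.adjoint_inner_left, hSs.adjoint_eq]
  have e3 : inner ℂ u ((K ^ (n + 2)) u) - T * inner ℂ v ((S ξ ^ (n + 2)) v)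
      = inner ℂ (planeWave T ξ (S ξ v)) B + inner ℂ A (planeWave T ξ ((S ξ ^ (n + 1)) v))
        + inner ℂ A B := by
    rw [e1, e2, ← inner_planeWave_planeWave hT ξ, hA, hB]
    simp only [inner_sub_left, inner_sub_right]
    ring
  have hSv : ‖S ξ v‖ₑ ≤ ‖S ξ‖ₑ := by simpa [hv] using (S ξ).le_opENorm v
  have hSnv : ‖(S ξ ^ (n + 1)) v‖ₑ ≤ (M : ℝ≥0∞) ^ n * ‖S ξ‖ₑ := by
    rw [pow_succ, mul_apply_eq_comp]
    exact (enorm_pow_apply_le hξ n _).trans (by gcongr)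
  rw [e3]
  refine (enorm_add_le _ _).trans ((add_le_add_left (enorm_add_le _ _) _).trans ?_)
  set t := ENNReal.ofReal √T
  calc _ ≤ (t * ‖S ξ‖ₑ) * ((n + 1 : ℕ) * (M : ℝ≥0∞) ^ (n + 1) * r)
        + r * (t * ((M : ℝ≥0∞) ^ n * ‖S ξ‖ₑ)) + r * ((n + 1 : ℕ) * (M : ℝ≥0∞) ^ (n + 1) * r) := by
        gcongr
        · refine (enorm_inner_le _ _).trans ?_
          rw [enorm_planeWave hT]
          gcongr
        · refine (enorm_inner_le _ _).trans ?_
          rw [enorm_planeWave hT]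
          gcongr
        · exact (enorm_inner_le _ _).trans (by gcongr)
    _ ≤ (t * ‖S ξ‖ₑ) * ((n + 1 : ℕ) * (M : ℝ≥0∞) ^ (n + 1) * r)
        + r * (t * ((M : ℝ≥0∞) ^ (n + 1) * ‖S ξ‖ₑ))
        + r * ((n + 2 : ℕ) * (M : ℝ≥0∞) ^ (n + 1) * r) := by
        gcongr
        · exact Nat.le_succ n
        · omega
    _ = (n + 2 : ℕ) * (M : ℝ≥0∞) ^ (n + 1) * (t * (‖S ξ‖ₑ * r) + r * r) := by push_cast; ring
    _ = _ := by rw [hr2]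

end Powers

/-! ### The limit theorem for powers -/

section PowerLimit

open scoped ENNReal NNReal

variable {p : ℕ} {T : ℝ} {S : ℝ → EuclideanSpace ℂ (Fin p) →L[ℂ] EuclideanSpace ℂ (Fin p)}
  {M : ℝ≥0} {K : L2 p T →L[ℂ] L2 p T}

theorem enorm_stdVec (a : Fin p) : ‖stdVec a‖ₑ = 1 := by
  rw [← ofReal_norm, PiLp.norm_single]
  simp

theorem IsSymbol.integrable_inner_pow (hS : IsSymbol S M) (n : ℕ)
    (v : EuclideanSpace ℂ (Fin p)) :
    Integrable fun ξ => (inner ℂ v ((S ξ ^ (n + 1)) v) : ℂ) := by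
  refine ((hS.integrable.norm.const_mul ((M : ℝ) ^ n * ‖v‖ ^ 2))).mono' ?_
    (hS.norm_le.mono fun ξ h => ?_)
  · exact ((ContinuousLinearMap.apply ℂ (EuclideanSpace ℂ (Fin p)) v).continuous.comp_aestronglyMeasurable
      (hS.integrable.1.pow (n + 1))).const_inner
  · refine (norm_inner_pow_succ_le (hS.nonneg ξ) h n v).trans ?_
    rw [mul_assoc]
    refine mul_le_mul_of_nonneg_left ?_ (by positivity)
    refine (Complex.re_le_norm _).trans ((norm_inner_le_norm _ _).trans ?_)
    calc ‖v‖ * ‖S ξ v‖ ≤ ‖v‖ * (‖S ξ‖ * ‖v‖) := by gcongr; exact (S ξ).le_opNorm v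
      _ = _ := by ring

/-- Integration over the frequencies: since `‖S ξ‖` and the square root of the oscillation are
square integrable, Hölder's inequality applies. -/
theorem enorm_planeWaveTrace_sub_le (hT : 0 < T) (hS : IsSymbol S M) (hM : 1 ≤ M)
    (hK : IsToeplitz T S K) (n : ℕ) :
    ‖planeWaveTrace (K ^ (n + 2)) - T * symbolTrace S (n + 2)‖ₑ
      ≤ p * ((n + 2 : ℕ) * (M : ℝ≥0∞) ^ (n + 1)) *
        (ENNReal.ofReal √T * ((∫⁻ ξ, ‖S ξ‖ₑ ^ 2) ^ (1 / 2 : ℝ)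
          * (∫⁻ ξ, oscillation T S ξ) ^ (1 / 2 : ℝ)) + ∫⁻ ξ, oscillation T S ξ) := by
  have hmo := aemeasurable_oscillation hS.integrable.1 T
  have hmS : AEMeasurable (fun ξ => ‖S ξ‖ₑ) := hS.integrable.1.enorm
  have i1 := (hK.hasSum_inner_pow hT.le hS (n + 1)).1
  have i2 : Integrable fun ξ => (T : ℂ) * ∑ a, inner ℂ (stdVec a) ((S ξ ^ (n + 2)) (stdVec a)) :=
    (integrable_finsetSum _ fun a _ => hS.integrable_inner_pow (n + 1) (stdVec a)).const_mul _
  rw [planeWaveTrace, symbolTrace, ← integral_const_mul, ← integral_sub i1 i2]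
  refine (enorm_integral_le_lintegral_enorm _).trans ?_
  set C : ℝ≥0∞ := (n + 2 : ℕ) * (M : ℝ≥0∞) ^ (n + 1) with hC
  have hCt : C ≠ ∞ := ENNReal.mul_ne_top (ENNReal.natCast_ne_top _)
    (ENNReal.pow_ne_top ENNReal.coe_ne_top)
  have h1 : ∀ᵐ ξ, ‖∑ a, inner ℂ (planeWave T ξ (stdVec a)) ((K ^ (n + 2)) (planeWave T ξ (stdVec a)))
      - T * ∑ a, inner ℂ (stdVec a) ((S ξ ^ (n + 2)) (stdVec a))‖ₑ
      ≤ p * C * (ENNReal.ofReal √T * (‖S ξ‖ₑ * oscillation T S ξ ^ (1 / 2 : ℝ))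
        + oscillation T S ξ) := by
    filter_upwards [hS.enorm_le] with ξ hξ
    rw [Finset.mul_sum, ← Finset.sum_sub_distrib]
    refine (enorm_sum_le _ _).trans ((Finset.sum_le_sum fun a _ =>
      enorm_inner_pow_planeWave_sub_le hT.le hS hM hK hξ (enorm_stdVec a) n).trans ?_)
    rw [Finset.sum_const, Finset.card_univ, Fintype.card_fin, nsmul_eq_mul]
    exact (mul_assoc _ _ _).ge
  refine (lintegral_mono_ae h1).trans ?_
  rw [lintegral_const_mul' _ _ (ENNReal.mul_ne_top (ENNReal.natCast_ne_top _) hCt),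
    lintegral_add_right' _ hmo, lintegral_const_mul' _ _ ENNReal.ofReal_ne_top]
  gcongr
  have h2 := ENNReal.lintegral_mul_le_Lp_mul_Lq (volume : Measure ℝ)
    (p := 2) (q := 2) Real.HolderConjugate.two_two hmS (hmo.pow_const (1 / 2 : ℝ))
  simp only [Pi.mul_apply, ← ENNReal.rpow_mul] at h2
  norm_num at h2
  norm_num
  exact h2

/-- The limit theorem for powers. -/
theorem tendsto_planeWaveTrace_pow (hS : IsSymbol S M) (hM : 1 ≤ M)
    {K : ∀ T : ℝ, L2 p T →L[ℂ] L2 p T} (hK : ∀ T, 0 < T → IsToeplitz T S (K T)) (n : ℕ) :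
    Tendsto (fun T : ℝ => (1 / T : ℂ) * planeWaveTrace (K T ^ (n + 1))) atTop
      (𝓝 (symbolTrace S (n + 1))) := by
  rcases n with _ | n
  · refine tendsto_const_nhds.congr' ((eventually_gt_atTop 0).mono fun T hT => ?_)
    have hT' : (T : ℂ) ≠ 0 := by exact_mod_cast hT.ne'
    beta_reduce
    rw [zero_add, pow_one, planeWaveTrace_pow_one hT.le hS (hK T hT)]
    field_simp
  · rw [tendsto_iff_edist_tendsto_0]
    set C : ℝ≥0∞ := p * ((n + 2 : ℕ) * (M : ℝ≥0∞) ^ (n + 1)) with hC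
    have hCt : C ≠ ∞ := ENNReal.mul_ne_top (ENNReal.natCast_ne_top _)
      (ENNReal.mul_ne_top (ENNReal.natCast_ne_top _) (ENNReal.pow_ne_top ENNReal.coe_ne_top))
    set B : ℝ≥0∞ := (∫⁻ ξ, ‖S ξ‖ₑ ^ 2) ^ (1 / 2 : ℝ) with hB
    have hBt : B ≠ ∞ := by
      refine ENNReal.rpow_ne_top_of_nonneg (by norm_num) ?_
      rw [lintegral_enorm_sq_eq_ofReal hS.memLp_two]
      exact ENNReal.ofReal_ne_top
    set q : ℝ → ℝ≥0∞ := fun T => (∫⁻ ξ, oscillation T S ξ) / ENNReal.ofReal T with hq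
    have hq0 : Tendsto q atTop (𝓝 0) := tendsto_lintegral_oscillation_div hS.memLp_two
    have hlim : Tendsto (fun T => C * (B * q T ^ (1 / 2 : ℝ) + q T)) atTop (𝓝 0) := by
      have h1 : Tendsto (fun T => q T ^ (1 / 2 : ℝ)) atTop (𝓝 0) := by
        have := (ENNReal.continuous_rpow_const (y := (1 / 2 : ℝ))).tendsto 0 |>.comp hq0
        rwa [ENNReal.zero_rpow_of_pos (by norm_num)] at this
      have h2 := ENNReal.Tendsto.const_mul (a := C)
        ((ENNReal.Tendsto.const_mul (a := B) h1 (Or.inr hBt)).add hq0) (Or.inr hCt)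
      simpa only [mul_zero, add_zero] using h2
    refine tendsto_of_tendsto_of_tendsto_of_le_of_le' tendsto_const_nhds hlim
      (Eventually.of_forall fun _ => zero_le) ((eventually_gt_atTop 0).mono fun T hT => ?_)
    have hT' : (T : ℂ) ≠ 0 := by exact_mod_cast hT.ne'
    set τ := ENNReal.ofReal T with hτ
    have hτ0 : τ ≠ 0 := (ENNReal.ofReal_pos.2 hT).ne'
    have hτt : τ ≠ ∞ := ENNReal.ofReal_ne_top
    have e1 : (1 / T : ℂ) * planeWaveTrace (K T ^ (n + 1 + 1)) - symbolTrace S (n + 1 + 1)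
        = (1 / T : ℂ) * (planeWaveTrace (K T ^ (n + 2)) - T * symbolTrace S (n + 2)) := by
      field_simp
    have e2 : ‖(1 / T : ℂ)‖ₑ = τ⁻¹ := by
      rw [← ofReal_norm, norm_div, norm_one, Complex.norm_real, Real.norm_of_nonneg hT.le, one_div,
        ENNReal.ofReal_inv_of_pos hT]
    have e3 : ∫⁻ ξ, oscillation T S ξ = τ * q T := by
      rw [hq, ENNReal.mul_div_cancel hτ0 hτt]
    have e4 : ENNReal.ofReal √T = τ ^ (1 / 2 : ℝ) := by
      rw [Real.sqrt_eq_rpow, ENNReal.ofReal_rpow_of_pos hT]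
    have e5 : τ ^ (1 / 2 : ℝ) * τ ^ (1 / 2 : ℝ) = τ := by
      rw [← ENNReal.rpow_add _ _ hτ0 hτt]
      norm_num
    rw [edist_eq_enorm_sub, e1, enorm_mul, e2]
    refine (mul_le_mul_right (enorm_planeWaveTrace_sub_le hT hS hM (hK T hT) n) _).trans ?_
    rw [e3, e4, ENNReal.mul_rpow_of_nonneg _ _ (by norm_num : (0 : ℝ) ≤ 1 / 2)]
    refine le_of_eq ?_
    calc τ⁻¹ * (C * (τ ^ (1 / 2 : ℝ) * (B * (τ ^ (1 / 2 : ℝ) * q T ^ (1 / 2 : ℝ))) + τ * q T))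
        = τ⁻¹ * (C * ((τ ^ (1 / 2 : ℝ) * τ ^ (1 / 2 : ℝ)) * (B * q T ^ (1 / 2 : ℝ)) + τ * q T)) := by
          ring
      _ = (τ⁻¹ * τ) * (C * (B * q T ^ (1 / 2 : ℝ) + q T)) := by rw [e5]; ring
      _ = _ := by rw [ENNReal.inv_mul_cancel hτ0 hτt, one_mul]

end PowerLimit

/-! ### Functional calculus of positive operators -/

section Calculus

open scoped ComplexOrder

variable {H : Type*} [NormedAddCommGroup H] [InnerProductSpace ℂ H] [CompleteSpace H]
  {K : H →L[ℂ] H} {M : ℝ}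

/-- The interval `[0, M]` of the real axis, as a subset of the complex plane. -/
abbrev segm (M : ℝ) : Set ℂ := (fun x : ℝ => (x : ℂ)) '' Set.Icc 0 M

theorem spectrum_subset_segm (hK : 0 ≤ K) (hM : ‖K‖ ≤ M) : spectrum ℂ K ⊆ segm M := by
  intro z hz
  have hnt : Nontrivial (H →L[ℂ] H) := by
    by_contra h
    rw [not_nontrivial_iff_subsingleton] at h
    rw [spectrum.of_subsingleton] at hz
    exact hz
  have hntH : Nontrivial H := by
    by_contra h
    rw [not_nontrivial_iff_subsingleton] at h
    exact not_nontrivial (H →L[ℂ] H) hnt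
  have h1 : z = z.re := hK.isSelfAdjoint.mem_spectrum_eq_re hz
  have h2 : (0 : ℂ) ≤ z := spectrum_nonneg_of_nonneg hK hz
  have h3 : ‖z‖ ≤ ‖K‖ := spectrum.norm_le_norm_of_mem hz
  refine ⟨z.re, ⟨(Complex.nonneg_iff.1 h2).1, ?_⟩, h1.symm⟩
  exact (Complex.re_le_norm z).trans (h3.trans hM)

/-- As `K g(K) = √K g(K) √K`, its diagonal matrix elements are at most `sup |g|` times those of
`K`. -/
theorem norm_inner_cfc_mul_le (hK : 0 ≤ K) {g : ℂ → ℂ}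
    (hg : ContinuousOn g (spectrum ℂ K)) {ε : ℝ} (hε : 0 ≤ ε)
    (hgε : ∀ z ∈ spectrum ℂ K, ‖g z‖ ≤ ε) (x : H) :
    ‖(inner ℂ x (cfc (fun z => z * g z) K x) : ℂ)‖ ≤ ε * (inner ℂ x (K x) : ℂ).re := by
  have hn : IsStarNormal K := hK.isSelfAdjoint.isStarNormal
  -- A continuous square root on the spectrum, which consists of nonnegative real numbers.
  set s : ℂ → ℂ := fun z => ((√z.re : ℝ) : ℂ) with hs
  have hsc : Continuous s := Complex.continuous_ofReal.comp
    (Real.continuous_sqrt.comp Complex.continuous_re)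
  set Y : H →L[ℂ] H := cfc s K with hYd
  have hY : IsSelfAdjoint Y := by
    rw [IsSelfAdjoint, hYd, ← cfc_star]
    simp [hs]
  have hss : Set.EqOn (fun z => s z * s z) id (spectrum ℂ K) := fun z hz => by
    have h2 := Complex.nonneg_iff.1 (spectrum_nonneg_of_nonneg hK hz)
    show ((√z.re : ℝ) : ℂ) * ((√z.re : ℝ) : ℂ) = z
    rw [← Complex.ofReal_mul, Real.mul_self_sqrt h2.1]
    exact Complex.ext rfl h2.2
  have hYY : Y * Y = K := by
    rw [hYd, ← cfc_mul s s K hsc.continuousOn hsc.continuousOn, cfc_congr hss, cfc_id ℂ K]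
  have e : cfc (fun z => z * g z) K = Y * (cfc g K * Y) := by
    rw [hYd, ← cfc_mul g s K hg hsc.continuousOn,
      ← cfc_mul s (fun z => g z * s z) K hsc.continuousOn (hg.mul hsc.continuousOn)]
    refine cfc_congr fun z hz => ?_
    have := hss hz
    simp only [id] at this
    calc z * g z = s z * s z * g z := by rw [this]
      _ = _ := by ring
  have hgn : ‖cfc g K‖ ≤ ε := norm_cfc_le hε hgε
  rw [e, mul_apply_eq_comp, ← ContinuousLinearMap.adjoint_inner_left, hY.adjoint_eq,
    mul_apply_eq_comp, ← hYY, inner_mul_self_apply hY, Complex.ofReal_re]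
  calc _ ≤ ‖Y x‖ * (‖cfc g (Y * Y)‖ * ‖Y x‖) :=
        (norm_inner_le_norm _ _).trans (by gcongr; exact ContinuousLinearMap.le_opNorm _ _)
    _ ≤ ‖Y x‖ * (ε * ‖Y x‖) := by rw [hYY]; gcongr
    _ = _ := by ring

/-- Uniform approximation of `φ(z) / z` by a polynomial `q(z)` controls the diagonal matrix
elements of `φ(K) - K q(K)`. -/
theorem norm_inner_cfc_sub_le (hK : 0 ≤ K) (hM : ‖K‖ ≤ M) {φ g : ℂ → ℂ}
    (hg : ContinuousOn g (segm M)) (hφ : ∀ z ∈ segm M, φ z = z * g z) (q : Polynomial ℂ)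
    {ε : ℝ} (hε : 0 ≤ ε) (hgε : ∀ z ∈ segm M, ‖g z - q.eval z‖ ≤ ε) (x : H) :
    ‖(inner ℂ x (cfc φ K x) : ℂ)
        - ∑ k ∈ Finset.range (q.natDegree + 1), q.coeff k * inner ℂ x ((K ^ (k + 1)) x)‖
      ≤ ε * (inner ℂ x (K x) : ℂ).re := by
  have hn : IsStarNormal K := hK.isSelfAdjoint.isStarNormal
  have hsp := spectrum_subset_segm hK hM
  have hgs : ContinuousOn g (spectrum ℂ K) := hg.mono hsp
  have hq : ContinuousOn (fun z => q.eval z) (spectrum ℂ K) := q.continuous.continuousOn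
  have e1 : cfc φ K = cfc (fun z => z * g z) K := cfc_congr fun z hz => hφ z (hsp hz)
  have e2 : cfc (fun z => z * q.eval z) K
      = ∑ k ∈ Finset.range (q.natDegree + 1), q.coeff k • K ^ (k + 1) := by
    rw [cfc_mul (fun z => z) (fun z => q.eval z) K continuousOn_id hq, cfc_polynomial q K]
    rw [show cfc (fun z : ℂ => z) K = K from cfc_id ℂ K, Polynomial.aeval_eq_sum_range,
      Finset.mul_sum]
    exact Finset.sum_congr rfl fun k _ => by rw [mul_smul_comm, pow_succ']
  have e3 : inner ℂ x (cfc (fun z => z * q.eval z) K x)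
      = ∑ k ∈ Finset.range (q.natDegree + 1), q.coeff k * inner ℂ x ((K ^ (k + 1)) x) := by
    rw [e2, sum_apply, inner_sum]
    exact Finset.sum_congr rfl fun k _ => by rw [smul_apply, inner_smul_right]
  have e4 : cfc (fun z => z * (g z - q.eval z)) K
      = cfc (fun z => z * g z) K - cfc (fun z => z * q.eval z) K := by
    rw [← cfc_sub (fun z => z * g z) (fun z => z * q.eval z) K (continuousOn_id.mul hgs)
      (continuousOn_id.mul hq)]
    simp only [mul_sub]
  rw [← e3, e1, ← inner_sub_right, ← sub_apply, ← e4]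
  exact norm_inner_cfc_mul_le hK (hgs.sub hq) hε (fun z hz => hgε z (hsp hz)) x

theorem norm_inner_cfc_le (hK : 0 ≤ K) (hM : ‖K‖ ≤ M) {φ g : ℂ → ℂ}
    (hg : ContinuousOn g (segm M)) (hφ : ∀ z ∈ segm M, φ z = z * g z)
    {ε : ℝ} (hε : 0 ≤ ε) (hgε : ∀ z ∈ segm M, ‖g z‖ ≤ ε) (x : H) :
    ‖(inner ℂ x (cfc φ K x) : ℂ)‖ ≤ ε * (inner ℂ x (K x) : ℂ).re := by
  have hsp := spectrum_subset_segm hK hM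
  rw [show cfc φ K = cfc (fun z => z * g z) K from cfc_congr fun z hz => hφ z (hsp hz)]
  exact norm_inner_cfc_mul_le hK (hg.mono hsp) hε (fun z hz => hgε z (hsp hz)) x

theorem abs_cfc_eq (hK : 0 ≤ K) {φ : ℂ → ℂ} (hφ : ContinuousOn φ (spectrum ℂ K)) :
    CFC.abs (cfc φ K) = cfc (fun z => ((‖φ z‖ : ℝ) : ℂ)) K := by
  have hn : IsStarNormal K := hK.isSelfAdjoint.isStarNormal
  have hc : ContinuousOn (fun z => ((‖φ z‖ : ℝ) : ℂ)) (spectrum ℂ K) :=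
    Complex.continuous_ofReal.comp_continuousOn hφ.norm
  refine CFC.sqrt_unique ?_ (cfc_nonneg fun z _ => by simp)
  rw [← cfc_star, ← cfc_mul _ _ K hc hc, ← cfc_mul _ _ K hφ.star hφ]
  refine cfc_congr fun z _ => ?_
  show ((‖φ z‖ : ℝ) : ℂ) * ((‖φ z‖ : ℝ) : ℂ) = star (φ z) * φ z
  rw [← sq]
  exact (Complex.conj_mul' (φ z)).symm

/-- The absolute value `|φ(K)|` is `K |g|(K)`. -/
theorem inner_abs_cfc_le (hK : 0 ≤ K) (hM : ‖K‖ ≤ M) {φ g : ℂ → ℂ}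
    (hg : ContinuousOn g (segm M)) (hφ : ∀ z ∈ segm M, φ z = z * g z)
    {ε : ℝ} (hε : 0 ≤ ε) (hgε : ∀ z ∈ segm M, ‖g z‖ ≤ ε) (x : H) :
    ‖(inner ℂ x (CFC.abs (cfc φ K) x) : ℂ)‖ ≤ ε * (inner ℂ x (K x) : ℂ).re := by
  have hsp := spectrum_subset_segm hK hM
  have hφc : ContinuousOn φ (segm M) := (continuousOn_id.mul hg).congr hφ
  rw [abs_cfc_eq hK (hφc.mono hsp)]
  refine norm_inner_cfc_le hK hM (g := fun z => ((‖g z‖ : ℝ) : ℂ))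
    (Complex.continuous_ofReal.comp_continuousOn hg.norm) ?_ hε (fun z hz => by simpa using hgε z hz) x
  rintro z ⟨t, ht, rfl⟩
  rw [hφ _ ⟨t, ht, rfl⟩, norm_mul]
  simp [abs_of_nonneg ht.1]

end Calculus

/-! ### Division by `z` and polynomial approximation -/

section Approximation

theorem eq_mul_dslope {φ : ℂ → ℂ} (h0 : φ 0 = 0) (z : ℂ) : φ z = z * dslope φ 0 z := by
  have := sub_smul_dslope φ 0 z
  rw [sub_zero, h0, sub_zero, smul_eq_mul] at this
  exact this.symm

theorem continuousOn_dslope_of_analyticOnNhd {φ : ℂ → ℂ} {s : Set ℂ} (hφ : AnalyticOnNhd ℂ φ s) :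
    ContinuousOn (dslope φ 0) s := by
  intro z hz
  refine ContinuousAt.continuousWithinAt ?_
  rcases eq_or_ne z 0 with rfl | h
  · exact continuousAt_dslope_same.2 (hφ _ hz).differentiableAt
  · exact (continuousAt_dslope_of_ne h).2 (hφ z hz).continuousAt

/-- Weierstrass' theorem for complex valued functions on `[0, M]`. -/
theorem exists_polynomial_near_on_segm {M : ℝ} {g : ℂ → ℂ} (hg : ContinuousOn g (segm M)) {ε : ℝ}
    (hε : 0 < ε) : ∃ q : Polynomial ℂ, ∀ z ∈ segm M, ‖g z - q.eval z‖ ≤ ε := by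
  have hc : ContinuousOn (fun x : ℝ => g x) (Set.Icc 0 M) :=
    hg.comp Complex.continuous_ofReal.continuousOn (Set.mapsTo_image _ _)
  obtain ⟨q₁, h₁⟩ := exists_polynomial_near_of_continuousOn 0 M (fun x => (g x).re)
    (Complex.continuous_re.comp_continuousOn hc) (ε / 2) (by positivity)
  obtain ⟨q₂, h₂⟩ := exists_polynomial_near_of_continuousOn 0 M (fun x => (g x).im)
    (Complex.continuous_im.comp_continuousOn hc) (ε / 2) (by positivity)
  refine ⟨q₁.map (algebraMap ℝ ℂ) + Polynomial.C Complex.I * q₂.map (algebraMap ℝ ℂ), ?_⟩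
  rintro z ⟨x, hx, rfl⟩
  have e : ∀ r : Polynomial ℝ, (r.map (algebraMap ℝ ℂ)).eval (x : ℂ) = ((r.eval x : ℝ) : ℂ) :=
    fun r => by
      rw [Polynomial.eval_map_algebraMap]
      exact Polynomial.aeval_algebraMap_apply_eq_algebraMap_eval x r
  simp only [Polynomial.eval_add, Polynomial.eval_mul, Polynomial.eval_C, e]
  refine (Complex.norm_le_abs_re_add_abs_im _).trans ?_
  have hr := (h₁ x hx).le
  have hi := (h₂ x hx).le
  rw [abs_sub_comm] at hr hi
  simp only [Complex.sub_re, Complex.add_re, Complex.sub_im, Complex.add_im, Complex.mul_re,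
    Complex.mul_im, Complex.ofReal_re, Complex.ofReal_im, Complex.I_re, Complex.I_im]
  ring_nf at hr hi ⊢
  linarith

theorem isCompact_segm (M : ℝ) : IsCompact (segm M) :=
  isCompact_Icc.image Complex.continuous_ofReal

theorem exists_bound_on_segm {M : ℝ} {g : ℂ → ℂ} (hg : ContinuousOn g (segm M)) :
    ∃ C : ℝ, 0 ≤ C ∧ ∀ z ∈ segm M, ‖g z‖ ≤ C := by
  obtain ⟨C, hC⟩ := (isCompact_segm M).exists_bound_of_continuousOn hg
  exact ⟨max C 0, le_max_right _ _, fun z hz => (hC z hz).trans (le_max_left _ _)⟩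

end Approximation

/-! ### Traces of functions of an operator -/

section OpTrace

variable {H : Type} [NormedAddCommGroup H] [InnerProductSpace ℂ H]
  {K : H →L[ℂ] H} {M : ℝ}

/-- The numbers `t k` are the traces of the powers `K ^ (k + 1)`. -/
def HasPowerTraces (K : H →L[ℂ] H) (t : ℕ → ℂ) : Prop :=
  ∀ (k : ℕ) {ι : Type} (b : HilbertBasis ι ℂ H),
    HasSum (fun i => inner ℂ (b i) ((K ^ (k + 1)) (b i))) (t k)

variable {t : ℕ → ℂ}

theorem HasPowerTraces.hasSum_re (ht : HasPowerTraces K t) {ι : Type} (b : HilbertBasis ι ℂ H) :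
    HasSum (fun i => (inner ℂ (b i) (K (b i)) : ℂ).re) (t 0).re := by
  have := Complex.hasSum_re (ht 0 b)
  simpa only [zero_add, pow_one] using this

variable [CompleteSpace H]

theorem HasPowerTraces.opTrace_pow (ht : HasPowerTraces K t) (k : ℕ) :
    opTrace (K ^ (k + 1)) = t k :=
  (ht k _).tsum_eq

theorem HasPowerTraces.re_nonneg (ht : HasPowerTraces K t) (hK : 0 ≤ K) : 0 ≤ (t 0).re := by
  obtain ⟨w, b, -⟩ := exists_hilbertBasis ℂ H
  exact (ht.hasSum_re b).nonneg fun i => inner_apply_re_nonneg hK _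

theorem HasPowerTraces.norm_le (ht : HasPowerTraces K t) (hK : 0 ≤ K) (hM : ‖K‖ ≤ M) (k : ℕ) :
    ‖t k‖ ≤ M ^ k * (t 0).re := by
  obtain ⟨w, b, -⟩ := exists_hilbertBasis ℂ H
  have h1 := (ht.hasSum_re b).mul_left (M ^ k)
  rw [← (ht k b).tsum_eq, ← h1.tsum_eq]
  exact tsum_of_norm_bounded h1.summable.hasSum fun i => norm_inner_pow_succ_le hK hM k _

/-- The matrix elements of `|φ(K)|` are dominated by a multiple of those of `K`. -/
theorem HasPowerTraces.isTraceClass_cfc (ht : HasPowerTraces K t) (hK : 0 ≤ K) (hM : ‖K‖ ≤ M)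
    {φ g : ℂ → ℂ} (hg : ContinuousOn g (segm M)) (hφ : ∀ z ∈ segm M, φ z = z * g z) :
    IsTraceClass (cfc φ K) := by
  intro ι b
  obtain ⟨C, hC0, hC⟩ := exists_bound_on_segm hg
  refine Summable.of_norm_bounded ((ht.hasSum_re b).summable.mul_left C) fun i => ?_
  exact (RCLike.norm_re_le_norm _).trans (inner_abs_cfc_le hK hM hg hφ hC0 hC _)

/-- Approximation of the trace of `φ(K)` by traces of powers, with an error proportional to the
trace of `K`. -/
theorem HasPowerTraces.norm_opTrace_cfc_sub_le (ht : HasPowerTraces K t) (hK : 0 ≤ K)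
    (hM : ‖K‖ ≤ M) {φ g : ℂ → ℂ} (hg : ContinuousOn g (segm M))
    (hφ : ∀ z ∈ segm M, φ z = z * g z) (q : Polynomial ℂ) {ε : ℝ} (hε : 0 ≤ ε)
    (hgε : ∀ z ∈ segm M, ‖g z - q.eval z‖ ≤ ε) :
    ‖opTrace (cfc φ K) - ∑ k ∈ Finset.range (q.natDegree + 1), q.coeff k * t k‖
      ≤ ε * (t 0).re := by
  obtain ⟨C, hC0, hC⟩ := exists_bound_on_segm hg
  set b := (exists_hilbertBasis ℂ H).choose_spec.choose with hb
  have h1 : Summable fun i => (inner ℂ (b i) (cfc φ K (b i)) : ℂ) :=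
    Summable.of_norm_bounded ((ht.hasSum_re b).summable.mul_left C) fun i =>
      norm_inner_cfc_le hK hM hg hφ hC0 hC _
  have h2 : HasSum (fun i => ∑ k ∈ Finset.range (q.natDegree + 1),
      q.coeff k * inner ℂ (b i) ((K ^ (k + 1)) (b i)))
      (∑ k ∈ Finset.range (q.natDegree + 1), q.coeff k * t k) :=
    hasSum_sum fun k _ => (ht k b).mul_left _
  have h3 := (ht.hasSum_re b).mul_left ε
  have h4 := h1.hasSum.sub h2
  have h5 : opTrace (cfc φ K) = ∑' i, inner ℂ (b i) (cfc φ K (b i)) := rfl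
  rw [h5, ← h4.tsum_eq]
  exact tsum_of_norm_bounded h3 fun i => norm_inner_cfc_sub_le hK hM hg hφ q hε hgε _

/-- If `g(z) = φ(z) / z` is a power series that converges absolutely at `M`, the trace of `φ(K)` may be
computed termwise: the partial sums approximate `g` uniformly on `[0, M]`. -/
theorem HasPowerTraces.hasSum_taylor (ht : HasPowerTraces K t) (hK : 0 ≤ K)
    (hM : ‖K‖ ≤ M) {φ g : ℂ → ℂ} (hg : ContinuousOn g (segm M))
    (hφ : ∀ z ∈ segm M, φ z = z * g z) {a : ℕ → ℂ} (ha : Summable fun k => ‖a k‖ * M ^ k)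
    (hag : ∀ z ∈ segm M, HasSum (fun k => a k * z ^ k) (g z)) :
    HasSum (fun k => a k * t k) (opTrace (cfc φ K)) := by
  have hM0 : 0 ≤ M := (norm_nonneg K).trans hM
  have hsum : Summable fun k => a k * t k := by
    refine Summable.of_norm_bounded (ha.mul_right (t 0).re) fun k => ?_
    rw [norm_mul, mul_assoc]
    exact mul_le_mul_of_nonneg_left (ht.norm_le hK hM k) (norm_nonneg _)
  have hunif : TendstoUniformlyOn (fun N z => ∑ k ∈ Finset.range N, a k * z ^ k)
      (fun z => ∑' k, a k * z ^ k) atTop (segm M) := by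
    refine tendstoUniformlyOn_tsum_nat ha ?_
    rintro k z ⟨x, hx, rfl⟩
    rw [norm_mul, norm_pow, Complex.norm_real, Real.norm_of_nonneg hx.1]
    exact mul_le_mul_of_nonneg_left (pow_le_pow_left₀ hx.1 hx.2 k) (norm_nonneg _)
  have hlim : Tendsto (fun N => ∑ k ∈ Finset.range N, a k * t k) atTop
      (𝓝 (opTrace (cfc φ K))) := by
    rw [Metric.tendsto_atTop]
    intro ε hε
    set δ : ℝ := ε / (2 * ((t 0).re + 1)) with hδ
    have ht0 := ht.re_nonneg hK
    have hδ0 : 0 < δ := by positivity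
    obtain ⟨N₀, hN₀⟩ := eventually_atTop.1 (Metric.tendstoUniformlyOn_iff.1 hunif δ hδ0)
    -- A sum over a nonempty range is a sum over the degrees of a polynomial.
    refine ⟨N₀ + 1, fun N hN => ?_⟩
    obtain ⟨N, rfl⟩ : ∃ N', N = N' + 1 := ⟨N - 1, by omega⟩
    set q : Polynomial ℂ := ∑ k ∈ Finset.range (N + 1), Polynomial.monomial k (a k) with hq
    have hqe : ∀ z, q.eval z = ∑ k ∈ Finset.range (N + 1), a k * z ^ k := fun z => by
      rw [hq, Polynomial.eval_finsetSum]
      simp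
    have hqc : ∀ k, q.coeff k = if k < N + 1 then a k else 0 := fun k => by
      rw [hq, Polynomial.finsetSum_coeff]
      simp [Polynomial.coeff_monomial]
    have hqd : q.natDegree + 1 ≤ N + 1 := by
      refine Nat.succ_le_succ (Polynomial.natDegree_sum_le_of_forall_le _ _ fun k hk => ?_)
      exact (Polynomial.natDegree_monomial_le _).trans (Finset.mem_range_succ_iff.1 hk)
    have hqs : ∑ k ∈ Finset.range (q.natDegree + 1), q.coeff k * t k
        = ∑ k ∈ Finset.range (N + 1), a k * t k := by
      rw [Finset.sum_subset (Finset.range_mono hqd) fun k _ hk => ?_]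
      · refine Finset.sum_congr rfl fun k hk => ?_
        rw [hqc, if_pos (Finset.mem_range.1 hk)]
      · rw [Polynomial.coeff_eq_zero_of_natDegree_lt, zero_mul]
        simpa [Nat.lt_succ_iff] using hk
    have h := ht.norm_opTrace_cfc_sub_le hK hM hg hφ q hδ0.le fun z hz => by
      have := hN₀ (N + 1) (by omega) z hz
      rw [(hag z hz).tsum_eq, dist_eq_norm, ← hqe] at this
      exact this.le
    rw [hqs] at h
    rw [dist_comm, dist_eq_norm]
    refine h.trans_lt ?_
    rw [hδ, div_mul_eq_mul_div, div_lt_iff₀ (by positivity)]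
    nlinarith
  exact (hsum.hasSum_iff_tendsto_nat).2 hlim

end OpTrace

/-! ### The limit theorem for functions of Toeplitz operators -/

section Limit

open scoped ENNReal NNReal

variable {p : ℕ} {T : ℝ} {S : ℝ → EuclideanSpace ℂ (Fin p) →L[ℂ] EuclideanSpace ℂ (Fin p)}
  {M : ℝ≥0} {K : L2 p T →L[ℂ] L2 p T}

theorem IsToeplitz.hasPowerTraces (hT : 0 ≤ T) (hS : IsSymbol S M) (hK : IsToeplitz T S K) :
    HasPowerTraces K fun k => planeWaveTrace (K ^ (k + 1)) :=
  fun k _ b => (hK.hasSum_inner_pow hT hS k).2 b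

/-- The trace of `φ` of the symbol. -/
def symbolFunTrace (S : ℝ → EuclideanSpace ℂ (Fin p) →L[ℂ] EuclideanSpace ℂ (Fin p))
    (φ : ℂ → ℂ) (ξ : ℝ) : ℂ :=
  ∑ a, inner ℂ (stdVec a) (cfc φ (S ξ) (stdVec a))

/-- The pointwise approximation of the trace of `φ` of the symbol by traces of powers. -/
theorem norm_symbolFunTrace_sub_le {X : EuclideanSpace ℂ (Fin p) →L[ℂ] EuclideanSpace ℂ (Fin p)}
    (hX : 0 ≤ X) {m : ℝ} (hM : ‖X‖ ≤ m) {φ g : ℂ → ℂ} (hg : ContinuousOn g (segm m))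
    (hφ : ∀ z ∈ segm m, φ z = z * g z) (q : Polynomial ℂ) {ε : ℝ} (hε : 0 ≤ ε)
    (hgε : ∀ z ∈ segm m, ‖g z - q.eval z‖ ≤ ε) :
    ‖∑ a, inner ℂ (stdVec a) (cfc φ X (stdVec a))
        - ∑ k ∈ Finset.range (q.natDegree + 1), q.coeff k *
          ∑ a, inner ℂ (stdVec a) ((X ^ (k + 1)) (stdVec a))‖
      ≤ ε * (∑ a, inner ℂ (stdVec a) (X (stdVec a)) : ℂ).re := by
  simp only [Finset.mul_sum]
  rw [Finset.sum_comm, ← Finset.sum_sub_distrib, Complex.re_sum, Finset.mul_sum]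
  exact (norm_sum_le _ _).trans (Finset.sum_le_sum fun a _ =>
    norm_inner_cfc_sub_le hX hM hg hφ q hε hgε _)

theorem IsSymbol.integrable_sum_inner_pow (hS : IsSymbol S M) (n : ℕ) :
    Integrable fun ξ => ∑ a, (inner ℂ (stdVec a) ((S ξ ^ (n + 1)) (stdVec a)) : ℂ) :=
  integrable_finsetSum _ fun _ _ => hS.integrable_inner_pow n _

theorem IsSymbol.integrable_poly (hS : IsSymbol S M) (q : Polynomial ℂ) :
    Integrable fun ξ => ∑ k ∈ Finset.range (q.natDegree + 1), q.coeff k *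
          ∑ a, (inner ℂ (stdVec a) ((S ξ ^ (k + 1)) (stdVec a)) : ℂ) :=
  integrable_finsetSum _ fun k _ => (hS.integrable_sum_inner_pow k).const_mul _

theorem IsSymbol.integrable_re (hS : IsSymbol S M) :
    Integrable fun ξ => (∑ a, inner ℂ (stdVec a) (S ξ (stdVec a)) : ℂ).re := by
  have := (hS.integrable_sum_inner_pow 0).re
  simpa only [zero_add, pow_one, RCLike.re_to_complex] using this

theorem IsSymbol.integral_re (hS : IsSymbol S M) :
    ∫ ξ, (∑ a, inner ℂ (stdVec a) (S ξ (stdVec a)) : ℂ).re = (symbolTrace S 1).re := by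
  have := _root_.integral_re (hS.integrable_sum_inner_pow 0)
  simp only [zero_add, pow_one, RCLike.re_to_complex] at this
  rw [symbolTrace]
  simp only [pow_one]
  exact this

/-- Measurability holds because polynomial functions of the symbol are measurable, integrability
because the trace of `φ(S)` is dominated by a multiple of the trace of `S`. -/
theorem IsSymbol.integrable_symbolFunTrace (hS : IsSymbol S M) {φ g : ℂ → ℂ}
    (hg : ContinuousOn g (segm M)) (hφ : ∀ z ∈ segm M, φ z = z * g z) :
    Integrable (symbolFunTrace S φ) := by
  have hpos : ∀ n : ℕ, (0 : ℝ) < 1 / (n + 1) := fun n => Nat.one_div_pos_of_nat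
  choose q hq using fun n : ℕ => exists_polynomial_near_on_segm hg (hpos n)
  have hm : AEStronglyMeasurable (symbolFunTrace S φ) := by
    refine aestronglyMeasurable_of_tendsto_ae atTop (fun n => (hS.integrable_poly (q n)).1)
      (hS.norm_le.mono fun ξ hξ => ?_)
    rw [tendsto_iff_norm_sub_tendsto_zero]
    have h0 := (tendsto_one_div_add_atTop_nhds_zero_nat (𝕜 := ℝ)).mul_const
      (∑ a, inner ℂ (stdVec a) (S ξ (stdVec a)) : ℂ).re
    rw [zero_mul] at h0
    refine squeeze_zero (fun _ => norm_nonneg _) (fun n => ?_) h0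
    rw [norm_sub_rev]
    exact norm_symbolFunTrace_sub_le (hS.nonneg ξ) hξ hg hφ (q n) (hpos n).le (hq n)
  obtain ⟨C, hC0, hC⟩ := exists_bound_on_segm hg
  refine (hS.integrable_re.const_mul C).mono' hm (hS.norm_le.mono fun ξ hξ => ?_)
  rw [Complex.re_sum, Finset.mul_sum]
  exact (norm_sum_le _ _).trans (Finset.sum_le_sum fun a _ =>
    norm_inner_cfc_le (hS.nonneg ξ) hξ hg hφ hC0 hC _)

theorem IsSymbol.norm_integral_symbolFunTrace_sub_le (hS : IsSymbol S M) {φ g : ℂ → ℂ}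
    (hg : ContinuousOn g (segm M)) (hφ : ∀ z ∈ segm M, φ z = z * g z) (q : Polynomial ℂ) {ε : ℝ}
    (hε : 0 ≤ ε) (hgε : ∀ z ∈ segm M, ‖g z - q.eval z‖ ≤ ε) :
    ‖(∫ ξ, symbolFunTrace S φ ξ)
        - ∑ k ∈ Finset.range (q.natDegree + 1), q.coeff k * symbolTrace S (k + 1)‖
      ≤ ε * (symbolTrace S 1).re := by
  have e : ∑ k ∈ Finset.range (q.natDegree + 1), q.coeff k * symbolTrace S (k + 1)
      = ∫ ξ, ∑ k ∈ Finset.range (q.natDegree + 1), q.coeff k *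
          ∑ a, (inner ℂ (stdVec a) ((S ξ ^ (k + 1)) (stdVec a)) : ℂ) := by
    rw [integral_finsetSum _ fun k _ => (hS.integrable_sum_inner_pow k).const_mul _]
    exact Finset.sum_congr rfl fun k _ => (integral_const_mul _ _).symm
  rw [e, ← integral_sub (hS.integrable_symbolFunTrace hg hφ) (hS.integrable_poly q),
    ← hS.integral_re, ← integral_const_mul]
  exact norm_integral_le_of_norm_le (hS.integrable_re.const_mul ε) (hS.norm_le.mono fun ξ hξ =>
    norm_symbolFunTrace_sub_le (hS.nonneg ξ) hξ hg hφ q hε hgε)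

theorem IsSymbol.mono {M' : ℝ≥0} (hS : IsSymbol S M) (h : M ≤ M') : IsSymbol S M' :=
  ⟨hS.integrable, hS.nonneg, hS.enorm_le.mono fun _ hξ => hξ.trans (by exact_mod_cast h)⟩

/-- The limit theorem for functions of Toeplitz operators, by uniform approximation of `φ(z) / z` by
polynomials. -/
theorem tendsto_opTrace_cfc (hS : IsSymbol S M) {K : ∀ T : ℝ, L2 p T →L[ℂ] L2 p T}
    (hK : ∀ T, 0 < T → IsToeplitz T S (K T)) {φ g : ℂ → ℂ}
    (hg : ContinuousOn g (segm M)) (hφ : ∀ z ∈ segm M, φ z = z * g z) :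
    Tendsto (fun T : ℝ => (1 / T : ℂ) * opTrace (cfc φ (K T))) atTop
      (𝓝 (∫ ξ, symbolFunTrace S φ ξ)) := by
  have hpow : ∀ n, Tendsto (fun T : ℝ => (1 / T : ℂ) * planeWaveTrace (K T ^ (n + 1))) atTop
      (𝓝 (symbolTrace S (n + 1))) := fun n =>
    -- The power limit wants a bound that is at least `1`.
    tendsto_planeWaveTrace_pow (hS.mono (le_max_left M 1)) (le_max_right M 1) hK n
  set s : ℝ := (symbolTrace S 1).re with hs
  have hs0 : 0 ≤ s := by
    rw [hs, ← hS.integral_re]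
    refine integral_nonneg fun ξ => ?_
    rw [Complex.re_sum]
    exact Finset.sum_nonneg fun a _ => inner_apply_re_nonneg (hS.nonneg ξ) _
  rw [Metric.tendsto_nhds]
  intro ε hε
  -- The approximation costs `δ s` on each side, and the power limit another `ε / 3`.
  set δ : ℝ := ε / (3 * (s + 1)) with hδ
  have hδ0 : 0 < δ := by positivity
  have hδs : δ * s < ε / 3 := by
    rw [hδ, div_mul_eq_mul_div, div_lt_div_iff₀ (by positivity) (by norm_num)]
    nlinarith
  obtain ⟨q, hq⟩ := exists_polynomial_near_on_segm hg hδ0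
  have hlim : Tendsto (fun T : ℝ => ∑ k ∈ Finset.range (q.natDegree + 1), q.coeff k *
      ((1 / T : ℂ) * planeWaveTrace (K T ^ (k + 1)))) atTop
      (𝓝 (∑ k ∈ Finset.range (q.natDegree + 1), q.coeff k * symbolTrace S (k + 1))) :=
    tendsto_finsetSum _ fun k _ => (hpow k).const_mul _
  have h2 := (Metric.tendsto_nhds.1 hlim) (ε / 3) (by positivity)
  filter_upwards [h2, eventually_gt_atTop 0] with T hT2 hT
  have hTc : (T : ℂ) ≠ 0 := by exact_mod_cast hT.ne'
  have h1 := ((hK T hT).hasPowerTraces hT.le hS).norm_opTrace_cfc_sub_le ((hK T hT).nonneg hS)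
    ((hK T hT).norm_le hS) hg hφ q hδ0.le hq
  have h3 := hS.norm_integral_symbolFunTrace_sub_le hg hφ q hδ0.le hq
  have h4 : dist ((1 / T : ℂ) * opTrace (cfc φ (K T)))
      (∑ k ∈ Finset.range (q.natDegree + 1), q.coeff k *
        ((1 / T : ℂ) * planeWaveTrace (K T ^ (k + 1)))) ≤ δ * s := by
    have e : ∑ k ∈ Finset.range (q.natDegree + 1), q.coeff k *
        ((1 / T : ℂ) * planeWaveTrace (K T ^ (k + 1)))
        = (1 / T : ℂ) * ∑ k ∈ Finset.range (q.natDegree + 1), q.coeff k *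
        planeWaveTrace (K T ^ (k + 1)) := by
      rw [Finset.mul_sum]
      exact Finset.sum_congr rfl fun k _ => by ring
    rw [e, dist_eq_norm, ← mul_sub, norm_mul, norm_div, norm_one, Complex.norm_real,
      Real.norm_of_nonneg hT.le, one_div, inv_mul_le_iff₀ hT]
    refine h1.trans (le_of_eq ?_)
    rw [zero_add, pow_one, planeWaveTrace_pow_one hT.le hS (hK T hT), Complex.re_ofReal_mul]
    ring
  calc dist ((1 / T : ℂ) * opTrace (cfc φ (K T))) (∫ ξ, symbolFunTrace S φ ξ)
      ≤ _ + _ := dist_triangle _ _ _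
    _ ≤ δ * s + (dist _ (∑ k ∈ Finset.range (q.natDegree + 1), q.coeff k * symbolTrace S (k + 1))
        + dist (∑ k ∈ Finset.range (q.natDegree + 1), q.coeff k * symbolTrace S (k + 1))
          (∫ ξ, symbolFunTrace S φ ξ)) := add_le_add h4 (dist_triangle _ _ _)
    _ < ε := by
        have h5 : dist (∑ k ∈ Finset.range (q.natDegree + 1), q.coeff k * symbolTrace S (k + 1))
          (∫ ξ, symbolFunTrace S φ ξ) ≤ δ * s := by
          rw [dist_comm, dist_eq_norm]
          exact h3
        linarith

end Limit

/-! ### The symbol of the system -/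

section Symbol

open scoped FourierTransform ENNReal NNReal Matrix ComplexOrder

variable {p m : ℕ} {f : ImpulseResponse p m} (hf : SqIntegrable f)

/-- The `(i, k)` entry of the frequency response, in the normalisation of Mathlib's Fourier
transform. -/
def transferEntry (i : Fin p) (k : Fin m) : Lp ℂ 2 (volume : Measure ℝ) :=
  𝓕 (MemLp.toLp _ (memLp_extend_ofReal hf i k))

/-- The entries of the spectral density, in the normalisation of Mathlib's Fourier transform. -/
def densityEntry (i j : Fin p) (ξ : ℝ) : ℂ :=
  ∑ k, inner ℂ (transferEntry hf j k ξ) (transferEntry hf i k ξ)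

theorem spectralDensity_apply (ξ : ℝ) (i j : Fin p) :
    spectralDensity f hf (2 * Real.pi * ξ) i j = densityEntry hf i j ξ := by
  have h : 2 * Real.pi * ξ / (2 * Real.pi) = ξ := mul_div_cancel_left₀ _ (by positivity)
  rw [spectralDensity, Matrix.mul_apply, densityEntry]
  refine Finset.sum_congr rfl fun k _ => ?_
  simp only [freqResponse, Matrix.conjTranspose_apply, Matrix.of_apply, h]
  rfl

theorem integrable_densityEntry (i j : Fin p) : Integrable (densityEntry hf i j) :=
  integrable_finsetSum _ fun _ _ => L2.integrable_inner _ _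

/-- The spectral density as an operator valued function of the frequency `ξ = ω / 2π`. -/
def densitySymbol (ξ : ℝ) : EuclideanSpace ℂ (Fin p) →L[ℂ] EuclideanSpace ℂ (Fin p) :=
  Matrix.toEuclideanCLM (n := Fin p) (𝕜 := ℂ) (spectralDensity f hf (2 * Real.pi * ξ))

theorem densitySymbol_apply (ξ : ℝ) (v : EuclideanSpace ℂ (Fin p)) (i : Fin p) :
    (densitySymbol hf ξ v).ofLp i = ∑ j, densityEntry hf i j ξ * v.ofLp j := by
  rw [densitySymbol, Matrix.ofLp_toEuclideanCLM, Matrix.mulVec, dotProduct]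
  simp only [spectralDensity_apply]

theorem toEuclideanCLM_eq_sum (X : Matrix (Fin p) (Fin p) ℂ) :
    Matrix.toEuclideanCLM (n := Fin p) (𝕜 := ℂ) X
      = ∑ i, ∑ j, X i j • Matrix.toEuclideanCLM (n := Fin p) (𝕜 := ℂ) (Matrix.single i j 1) := by
  let L : Matrix (Fin p) (Fin p) ℂ →ₗ[ℂ] (EuclideanSpace ℂ (Fin p) →L[ℂ] EuclideanSpace ℂ (Fin p)) :=
    (Matrix.toEuclideanCLM (n := Fin p) (𝕜 := ℂ)).toAlgEquiv.toLinearMap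
  have e : L X = ∑ i, ∑ j, X i j • L (Matrix.single i j 1) := by
    conv_lhs => rw [Matrix.matrix_eq_sum_single X]
    simp only [map_sum, ← map_smul, Matrix.smul_single, smul_eq_mul, mul_one]
  exact e

/-- Stated for a general space of values, so that `integrable_densitySymbol` does not have to unfold
the norm of operators. -/
theorem integrable_sum_densityEntry_smul {W : Type*} [NormedAddCommGroup W] [NormedSpace ℂ W]
    (A : Fin p → Fin p → W) : Integrable fun ξ => ∑ i, ∑ j, densityEntry hf i j ξ • A i j :=
  integrable_finsetSum _ fun i _ => integrable_finsetSum _ fun j _ =>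
    (integrable_densityEntry hf i j).smul_const (A i j)

theorem integrable_densitySymbol : Integrable (densitySymbol hf) := by
  refine (integrable_sum_densityEntry_smul hf fun i j =>
    Matrix.toEuclideanCLM (n := Fin p) (𝕜 := ℂ) (Matrix.single i j 1)).congr
    (ae_of_all _ fun ξ => ?_)
  rw [densitySymbol, toEuclideanCLM_eq_sum]
  simp only [spectralDensity_apply]

theorem toEuclideanCLM_nonneg {X : Matrix (Fin p) (Fin p) ℂ} (hX : X.PosSemidef) :
    0 ≤ Matrix.toEuclideanCLM (n := Fin p) (𝕜 := ℂ) X := by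
  rw [ContinuousLinearMap.nonneg_iff_isPositive, ContinuousLinearMap.isPositive_iff_complex]
  intro x
  have h := hX.dotProduct_mulVec_nonneg x.ofLp
  have e : inner ℂ x (Matrix.toEuclideanCLM (n := Fin p) (𝕜 := ℂ) X x)
      = star x.ofLp ⬝ᵥ X *ᵥ x.ofLp := by
    rw [EuclideanSpace.inner_eq_star_dotProduct, Matrix.ofLp_toEuclideanCLM, dotProduct_comm]
  have h2 := Complex.nonneg_iff.1 h
  rw [← inner_conj_symm, e]
  refine ⟨Complex.ext ?_ ?_, ?_⟩
  · simp
  · simp [← h2.2]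
  · simpa using h2.1

theorem densitySymbol_nonneg (ξ : ℝ) : 0 ≤ densitySymbol hf ξ :=
  toEuclideanCLM_nonneg (Matrix.posSemidef_self_mul_conjTranspose _)

open scoped Matrix.Norms.L2Operator in
/-- The identity `‖F̂ F̂^*‖ = ‖F̂‖²`. -/
theorem norm_densitySymbol (ξ : ℝ) :
    ‖densitySymbol hf ξ‖ = ‖freqResponse f hf (2 * Real.pi * ξ)‖ ^ 2 := by
  rw [densitySymbol, Matrix.l2_opNorm_toEuclideanCLM, spectralDensity, sq]
  have := Matrix.l2_opNorm_conjTranspose_mul_self (freqResponse f hf (2 * Real.pi * ξ))ᴴ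
  rwa [Matrix.conjTranspose_conjTranspose, Matrix.l2_opNorm_conjTranspose] at this

theorem quasiMeasurePreserving_two_pi_mul :
    Measure.QuasiMeasurePreserving (fun ξ : ℝ => 2 * Real.pi * ξ) volume volume :=
  Measure.quasiMeasurePreserving_smul (volume : Measure ℝ) (r := 2 * Real.pi) (by positivity)

open scoped Matrix.Norms.L2Operator in
theorem isSymbol_densitySymbol (hinf : hInfNorm f hf ≠ ⊤) :
    IsSymbol (densitySymbol hf) ((hInfNorm f hf).toNNReal ^ 2) where
  integrable := integrable_densitySymbol hf
  nonneg := densitySymbol_nonneg hf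
  enorm_le := by
    have h1 : ∀ᵐ ω, _ ≤ hInfNorm f hf := ENNReal.ae_le_essSup _
    filter_upwards [quasiMeasurePreserving_two_pi_mul.ae h1] with ξ hξ
    have h2 := ENNReal.toReal_mono hinf hξ
    rw [toReal_enorm] at h2
    rw [← ofReal_norm, norm_densitySymbol, ENNReal.coe_pow, ENNReal.coe_toNNReal hinf,
      ← ENNReal.ofReal_toReal hinf, ← ENNReal.ofReal_pow ENNReal.toReal_nonneg]
    exact ENNReal.ofReal_le_ofReal (pow_le_pow_left₀ (norm_nonneg _) h2 2)

/-- The covariance function is the inverse Fourier transform of the spectral density. -/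
theorem covFun_eq_integral_densityEntry (u : ℝ) (i j : Fin p) :
    (covFun f u i j : ℂ) = ∫ ξ, (Real.fourierChar (ξ * u) : ℂ) * densityEntry hf i j ξ := by
  have hmem : ∀ k, MemLp (fun x => ((extend f i k (x + u) : ℝ) : ℂ)) 2 := fun k =>
    (memLp_extend_ofReal hf i k).comp_measurePreserving (measurePreserving_add_right volume u)
  have h1 : ∀ k, ∫ τ, ((extend f i k (u - τ) * extend f j k (0 - τ) : ℝ) : ℂ)
      = ∫ ξ, (Real.fourierChar (ξ * u) : ℂ) *
          inner ℂ (transferEntry hf j k ξ) (transferEntry hf i k ξ) := by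
    intro k
    -- Plancherel's theorem for `f j k` and the translate of `f i k` by `u`.
    have e := Lp.inner_fourier_eq ((memLp_extend_ofReal hf j k).toLp _) ((hmem k).toLp _)
    rw [L2.inner_def, L2.inner_def] at e
    calc ∫ τ, ((extend f i k (u - τ) * extend f j k (0 - τ) : ℝ) : ℂ)
        = ∫ τ, ((extend f i k (τ + u) * extend f j k τ : ℝ) : ℂ) := by
          rw [← integral_neg_eq_self]
          refine integral_congr_ae (ae_of_all _ fun τ => ?_)
          simp only [sub_neg_eq_add, zero_add, add_comm u]
      _ = _ := ?_
    refine Eq.trans (integral_congr_ae ?_) (e.symm.trans (integral_congr_ae ?_))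
    · filter_upwards [(memLp_extend_ofReal hf j k).coeFn_toLp, (hmem k).coeFn_toLp] with τ h h'
      rw [h, h', RCLike.inner_apply, Complex.conj_ofReal, Complex.ofReal_mul]
    · filter_upwards [fourier_toLp_comp_add (memLp_extend_ofReal hf i k) u (hmem k)] with ξ h
      rw [h, smul_eq_mul, RCLike.inner_apply, RCLike.inner_apply, mul_assoc]
      rfl
  have hi : ∀ k, Integrable fun τ => extend f i k (u - τ) * extend f j k (0 - τ) := fun k =>
    ((memLp_extend hf i k).comp_measurePreserving
      (Measure.measurePreserving_sub_left volume u)).integrable_mul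
      ((memLp_extend hf j k).comp_measurePreserving (Measure.measurePreserving_sub_left volume 0))
  have hi2 : ∀ k, Integrable fun ξ => (Real.fourierChar (ξ * u) : ℂ) *
          inner ℂ (transferEntry hf j k ξ) (transferEntry hf i k ξ) := fun k => by
    refine (L2.integrable_inner (𝕜 := ℂ) (transferEntry hf j k) (transferEntry hf i k)).bdd_mul
      (c := 1) (Continuous.aestronglyMeasurable ?_) (ae_of_all _ fun ξ => (Circle.norm_coe _).le)
    exact continuous_subtype_val.comp
      (Real.continuous_fourierChar.comp (continuous_id.mul continuous_const))
  rw [covFun_eq, ← integral_complex_ofReal]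
  simp only [densityEntry, Finset.mul_sum, Complex.ofReal_sum]
  rw [integral_finsetSum _ fun k _ => (hi k).ofReal, integral_finsetSum _ fun k _ => hi2 k]
  exact Finset.sum_congr rfl fun k _ => h1 k

/-! ### The covariance operator in the frequency domain -/

theorem continuous_fourierChar_mul :
    Continuous fun z : ℝ × ℝ => (Real.fourierChar (z.1 * z.2) : ℂ) :=
  continuous_subtype_val.comp (Real.continuous_fourierChar.comp (continuous_fst.mul continuous_snd))

/-- Fubini's theorem for the Fourier kernel. -/
theorem integral_fourierChar_swap {μ ν : Measure ℝ} [SFinite μ] [SFinite ν] {a b : ℝ → ℂ}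
    (ha : Integrable a μ) (hb : Integrable b ν) :
    ∫ s, a s * ∫ ξ, (Real.fourierChar (s * ξ) : ℂ) * b ξ ∂ν ∂μ
      = ∫ ξ, b ξ * ∫ s, (Real.fourierChar (s * ξ) : ℂ) * a s ∂μ ∂ν := by
  have hi : Integrable (fun z : ℝ × ℝ => (Real.fourierChar (z.1 * z.2) : ℂ) * (a z.1 * b z.2))
      (μ.prod ν) :=
    (ha.mul_prod hb).bdd_mul (c := 1) continuous_fourierChar_mul.aestronglyMeasurable
      (ae_of_all _ fun z => (Circle.norm_coe _).le)
  have := integral_integral_swap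
    (f := fun s ξ => (Real.fourierChar (s * ξ) : ℂ) * (a s * b ξ)) hi
  simp only [← integral_const_mul]
  refine Eq.trans ?_ (this.trans ?_)
  · exact integral_congr_ae (ae_of_all _ fun s => integral_congr_ae (ae_of_all _ fun ξ => by
      ring))
  · exact integral_congr_ae (ae_of_all _ fun s => integral_congr_ae (ae_of_all _ fun ξ => by
      ring))

theorem continuous_integral_fourierChar {ν : Measure ℝ} {b : ℝ → ℂ} (hb : Integrable b ν) :
    Continuous fun s => ∫ ξ, (Real.fourierChar (s * ξ) : ℂ) * b ξ ∂ν := by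
  have h : Continuous (VectorFourier.fourierIntegral Real.fourierChar ν (innerₗ ℝ) b) :=
    VectorFourier.fourierIntegral_continuous Real.continuous_fourierChar
      (by exact continuous_inner) hb
  refine (h.comp continuous_neg).congr fun s => ?_
  simp only [Function.comp, VectorFourier.fourierIntegral]
  refine integral_congr_ae (ae_of_all _ fun ξ => ?_)
  simp [Circle.smul_def, mul_comm]

theorem norm_integral_fourierChar_le {ν : Measure ℝ} (b : ℝ → ℂ) (s : ℝ) :
    ‖∫ ξ, (Real.fourierChar (s * ξ) : ℂ) * b ξ ∂ν‖ ≤ ∫ ξ, ‖b ξ‖ ∂ν := by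
  refine (norm_integral_le_integral_norm _).trans (le_of_eq ?_)
  exact integral_congr_ae (ae_of_all _ fun ξ => by
    show ‖(Real.fourierChar (s * ξ) : ℂ) * b ξ‖ = ‖b ξ‖
    rw [norm_mul, Circle.norm_coe, one_mul])

theorem boxFourier_coord {T : ℝ} (ψ : L2 p T) (ξ : ℝ) (j : Fin p) :
    (boxFourier ψ ξ).ofLp j
      = ∫ t in Set.Icc 0 T, (Real.fourierChar (t * -ξ) : ℂ) * (ψ t).ofLp j := by
  have hi : Integrable (fun t => Real.fourierChar (-(t * ξ)) • ψ t)
      (volume.restrict (Set.Icc 0 T)) := by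
    have h : Integrable ψ (volume.restrict (Set.Icc 0 T)) := (Lp.memLp ψ).integrable (by norm_num)
    refine h.mono (AEStronglyMeasurable.smul (Continuous.aestronglyMeasurable ?_) h.1)
      (ae_of_all _ fun t => (Circle.norm_smul _ _).le)
    exact continuous_subtype_val.comp
      (Real.continuous_fourierChar.comp (continuous_id.mul continuous_const).neg)
  have := ContinuousLinearMap.integral_comp_comm (EuclideanSpace.proj (𝕜 := ℂ) j) hi
  rw [boxFourier_apply]
  refine this.symm.trans (integral_congr_ae (ae_of_all _ fun t => ?_))
  show (Real.fourierChar (-(t * ξ)) : ℂ) * (ψ t).ofLp j = _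
  rw [← mul_neg]

theorem conj_boxFourier_coord {T : ℝ} (ψ : L2 p T) (ξ : ℝ) (j : Fin p) :
    (starRingEnd ℂ) ((boxFourier ψ ξ).ofLp j)
      = ∫ t in Set.Icc 0 T, (Real.fourierChar (t * ξ) : ℂ) * (starRingEnd ℂ) ((ψ t).ofLp j) := by
  rw [boxFourier_coord, ← integral_conj]
  refine integral_congr_ae (ae_of_all _ fun t => ?_)
  show (starRingEnd ℂ) ((Real.fourierChar (t * -ξ) : ℂ) * (ψ t).ofLp j) = _
  rw [map_mul, ← Circle.coe_inv_eq_conj, ← AddChar.map_neg_eq_inv, mul_neg, neg_neg]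

end Symbol

section Operator

open scoped FourierTransform ENNReal NNReal Matrix ComplexOrder

variable {p m : ℕ} {f : ImpulseResponse p m} (hf : SqIntegrable f) {T : ℝ}

theorem integrable_densityEntry_mul_boxFourier (χ : L2 p T) (i j : Fin p) :
    Integrable fun ξ => densityEntry hf i j ξ * (boxFourier χ ξ).ofLp j := by
  refine (integrable_densityEntry hf i j).mul_bdd (c := ∫ t in Set.Icc 0 T, ‖(χ t).ofLp j‖)
    (Continuous.aestronglyMeasurable ?_) (ae_of_all _ fun ξ => ?_)
  · exact (EuclideanSpace.proj (𝕜 := ℂ) j).continuous.comp (continuous_boxFourier χ)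
  · rw [boxFourier_coord]
    simp only [mul_comm _ (-ξ)]
    exact (norm_integral_le_integral_norm _).trans (le_of_eq (integral_congr_ae
      (ae_of_all _ fun t => by
        show ‖(Real.fourierChar (-ξ * t) : ℂ) * (χ t).ofLp j‖ = ‖(χ t).ofLp j‖
        rw [norm_mul, Circle.norm_coe, one_mul])))

/-- Convolution with the covariance function is multiplication by the spectral density in the
frequency domain. -/
theorem integral_covFun_mul (χ : L2 p T) (s : ℝ) (i j : Fin p) :
    ∫ t in Set.Icc 0 T, (covFun f (s - t) i j : ℂ) * (χ t).ofLp j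
      = ∫ ξ, (Real.fourierChar (s * ξ) : ℂ) *
          (densityEntry hf i j ξ * (boxFourier χ ξ).ofLp j) := by
  have hc : Integrable fun ξ => (Real.fourierChar (s * ξ) : ℂ) * densityEntry hf i j ξ :=
    (integrable_densityEntry hf i j).bdd_mul (c := 1) (Continuous.aestronglyMeasurable
      (continuous_fourierChar_mul.comp (continuous_const.prodMk continuous_id)))
      (ae_of_all _ fun ξ => (Circle.norm_coe _).le)
  have h := integral_fourierChar_swap (integrable_coord χ j) hc.comp_neg
  rw [← integral_neg_eq_self (fun ξ : ℝ => (Real.fourierChar (s * ξ) : ℂ) *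
    (densityEntry hf i j ξ * (boxFourier χ ξ).ofLp j))]
  refine Eq.trans (integral_congr_ae (ae_of_all _ fun t => ?_)) (h.trans
    (integral_congr_ae (ae_of_all _ fun ξ => ?_)))
  · show (covFun f (s - t) i j : ℂ) * (χ t).ofLp j = _
    rw [mul_comm, covFun_eq_integral_densityEntry hf, ← integral_neg_eq_self]
    congr 1
    refine integral_congr_ae (ae_of_all _ fun ξ => ?_)
    show (Real.fourierChar (-ξ * (s - t)) : ℂ) * densityEntry hf i j (-ξ)
      = (Real.fourierChar (t * ξ) : ℂ) *
        ((Real.fourierChar (s * -ξ) : ℂ) * densityEntry hf i j (-ξ))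
    rw [← mul_assoc, ← Circle.coe_mul, ← AddChar.map_add_eq_mul]
    ring_nf
  · show (Real.fourierChar (s * -ξ) : ℂ) * densityEntry hf i j (-ξ) * _
      = (Real.fourierChar (s * -ξ) : ℂ) * (densityEntry hf i j (-ξ) * (boxFourier χ (-ξ)).ofLp j)
    rw [boxFourier_coord, neg_neg, mul_assoc]

theorem integrable_conj_coord (ψ : L2 p T) (i : Fin p) :
    Integrable (fun s => (starRingEnd ℂ) ((ψ s).ofLp i)) (volume.restrict (Set.Icc 0 T)) :=
  Complex.conjCLE.toContinuousLinearMap.integrable_comp (integrable_coord ψ i)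

/-- The covariance operator is the truncated convolution operator with the spectral density as its
symbol. -/
theorem isToeplitz_covOperator : IsToeplitz T (densitySymbol hf) (covOperator f hf T) := by
  intro ψ χ
  have hc := integrable_densityEntry_mul_boxFourier hf χ
  have e1 : inner ℂ ψ (covOperator f hf T χ) = ∫ s in Set.Icc 0 T, ∑ i, ∑ j,
      (starRingEnd ℂ) ((ψ s).ofLp i) * ∫ ξ, (Real.fourierChar (s * ξ) : ℂ) *
          (densityEntry hf i j ξ * (boxFourier χ ξ).ofLp j) := by
    rw [L2.inner_def]
    have hK : covOperator f hf T χ =ᵐ[volume.restrict (Set.Icc 0 T)] covIntegral f T χ :=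
      (memLp_covIntegral hf χ).coeFn_toLp
    refine integral_congr_ae (hK.mono fun s hs => ?_)
    simp only [hs]
    rw [PiLp.inner_apply]
    refine Finset.sum_congr rfl fun i _ => ?_
    rw [RCLike.inner_apply, covIntegral_apply hf, mul_comm, Finset.mul_sum]
    exact Finset.sum_congr rfl fun j _ => by rw [integral_covFun_mul hf]
  have hi : ∀ i j, Integrable (fun s => (starRingEnd ℂ) ((ψ s).ofLp i) *
      ∫ ξ, (Real.fourierChar (s * ξ) : ℂ) * (densityEntry hf i j ξ * (boxFourier χ ξ).ofLp j))
      (volume.restrict (Set.Icc 0 T)) := fun i j =>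
    (integrable_conj_coord ψ i).mul_bdd
      (continuous_integral_fourierChar (hc i j)).aestronglyMeasurable
      (ae_of_all _ fun s => norm_integral_fourierChar_le _ s)
  have e2 : ∀ i j, ∫ s in Set.Icc 0 T, (starRingEnd ℂ) ((ψ s).ofLp i) *
      ∫ ξ, (Real.fourierChar (s * ξ) : ℂ) * (densityEntry hf i j ξ * (boxFourier χ ξ).ofLp j)
      = ∫ ξ, densityEntry hf i j ξ * (boxFourier χ ξ).ofLp j *
          (starRingEnd ℂ) ((boxFourier ψ ξ).ofLp i) := fun i j => by
    rw [integral_fourierChar_swap (integrable_conj_coord ψ i) (hc i j)]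
    simp only [conj_boxFourier_coord]
  have hr : ∀ i j, Integrable fun ξ => densityEntry hf i j ξ * (boxFourier χ ξ).ofLp j *
          (starRingEnd ℂ) ((boxFourier ψ ξ).ofLp i) := fun i j => by
    refine (hc i j).mul_bdd (c := ∫ s in Set.Icc 0 T, ‖(starRingEnd ℂ) ((ψ s).ofLp i)‖)
      (Continuous.aestronglyMeasurable ?_) (ae_of_all _ fun ξ => ?_)
    · exact Complex.continuous_conj.comp
        ((EuclideanSpace.proj (𝕜 := ℂ) i).continuous.comp (continuous_boxFourier ψ))
    · rw [conj_boxFourier_coord]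
      simp only [mul_comm _ ξ]
      exact norm_integral_fourierChar_le _ ξ
  rw [e1, integral_finsetSum _ fun i _ => integrable_finsetSum _ fun j _ => hi i j]
  have e3 : ∀ ξ, inner ℂ (boxFourier ψ ξ) (densitySymbol hf ξ (boxFourier χ ξ))
      = ∑ i, ∑ j, densityEntry hf i j ξ * (boxFourier χ ξ).ofLp j *
          (starRingEnd ℂ) ((boxFourier ψ ξ).ofLp i) := fun ξ => by
    rw [PiLp.inner_apply]
    refine Finset.sum_congr rfl fun i _ => ?_
    rw [RCLike.inner_apply, densitySymbol_apply, Finset.sum_mul]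
  simp only [e3]
  rw [integral_finsetSum _ fun i _ => integrable_finsetSum _ fun j _ => hr i j]
  refine Finset.sum_congr rfl fun i _ => ?_
  rw [integral_finsetSum _ fun j _ => hi i j, integral_finsetSum _ fun j _ => hr i j]
  exact Finset.sum_congr rfl fun j _ => e2 i j

end Operator

/-! ### The spectral functional in terms of the symbol -/

section Cost

open scoped FourierTransform ENNReal NNReal Matrix ComplexOrder

variable {p m : ℕ} {f : ImpulseResponse p m} (hf : SqIntegrable f) {T : ℝ}

theorem trace_eq_sum_inner (X : Matrix (Fin p) (Fin p) ℂ) :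
    X.trace = ∑ a, inner ℂ (stdVec a) (Matrix.toEuclideanCLM (n := Fin p) (𝕜 := ℂ) X (stdVec a)) := by
  refine Finset.sum_congr rfl fun a _ => ?_
  simp [EuclideanSpace.inner_single_left, Matrix.ofLp_toEuclideanCLM]

open scoped Matrix.Norms.L2Operator in
theorem toEuclideanCLM_cfc {X : Matrix (Fin p) (Fin p) ℂ} (hX : IsStarNormal X) {φ : ℂ → ℂ}
    (hφ : ContinuousOn φ (spectrum ℂ (Matrix.toEuclideanCLM (n := Fin p) (𝕜 := ℂ) X))) :
    Matrix.toEuclideanCLM (n := Fin p) (𝕜 := ℂ) (cfc φ X)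
      = cfc φ (Matrix.toEuclideanCLM (n := Fin p) (𝕜 := ℂ) X) := by
  have hs : spectrum ℂ (Matrix.toEuclideanCLM (n := Fin p) (𝕜 := ℂ) X) = spectrum ℂ X :=
    AlgEquiv.spectrum_eq (Matrix.toEuclideanCLM (n := Fin p) (𝕜 := ℂ)) X
  refine StarAlgHomClass.map_cfc (S := ℂ) (Matrix.toEuclideanCLM (n := Fin p) (𝕜 := ℂ)) φ X
    (hs ▸ hφ) ?_ hX ?_
  · have h : Isometry (Matrix.toEuclideanCLM (n := Fin p) (𝕜 := ℂ)) :=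
      AddMonoidHomClass.isometry_of_norm _ Matrix.l2_opNorm_toEuclideanCLM
    exact h.continuous
  · exact hX.map _

/-- The functional calculus of matrices agrees with that of operators on `ℂ^p`. The bound on the norm
keeps the spectrum inside the set on which `φ` is continuous, since for a discontinuous function `cfc` has its
default value `0`. -/
theorem traceSpectral_eq_symbolFunTrace {φ : ℂ → ℂ} {M : ℝ} (hφ : ContinuousOn φ (segm M)) {ξ : ℝ}
    (hM : ‖densitySymbol hf ξ‖ ≤ M) :
    traceSpectral f hf φ (2 * Real.pi * ξ) = symbolFunTrace (densitySymbol hf) φ ξ := by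
  have hX : IsStarNormal (spectralDensity f hf (2 * Real.pi * ξ)) :=
    (Matrix.isHermitian_mul_conjTranspose_self _).isSelfAdjoint.isStarNormal
  rw [traceSpectral, trace_eq_sum_inner, toEuclideanCLM_cfc hX
    (hφ.mono (spectrum_subset_segm (densitySymbol_nonneg hf ξ) hM))]
  rfl

theorem integrable_traceSpectral {φ : ℂ → ℂ} {M : ℝ≥0} (hS : IsSymbol (densitySymbol hf) M)
    {g : ℂ → ℂ} (hc : ContinuousOn φ (segm M)) (hg : ContinuousOn g (segm M))
    (hφ : ∀ z ∈ segm M, φ z = z * g z) :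
    Integrable (traceSpectral f hf φ) := by
  rw [← integrable_comp_mul_left_iff _ (R := 2 * Real.pi) (by positivity)]
  refine (hS.integrable_symbolFunTrace hg hφ).congr (hS.norm_le.mono fun ξ hξ => ?_)
  exact (traceSpectral_eq_symbolFunTrace hf hc hξ).symm

theorem covAnalyticCost_eq {φ : ℂ → ℂ} {M : ℝ≥0} (hS : IsSymbol (densitySymbol hf) M)
    (hc : ContinuousOn φ (segm M)) :
    covAnalyticCost f hf φ = ∫ ξ, symbolFunTrace (densitySymbol hf) φ ξ := by
  have h : ∫ ξ, symbolFunTrace (densitySymbol hf) φ ξ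
      = ∫ ξ, traceSpectral f hf φ (2 * Real.pi * ξ) :=
    integral_congr_ae (hS.norm_le.mono fun ξ hξ => (traceSpectral_eq_symbolFunTrace hf hc hξ).symm)
  rw [h, Measure.integral_comp_mul_left, covAnalyticCost, abs_of_pos (by positivity),
    Complex.real_smul]
  push_cast
  rw [one_div]

end Cost

/-! ### Taylor series -/

section Taylor

/-- By compactness, a function that is analytic near a closed disc is analytic on a larger open one. -/
theorem exists_differentiableOn_ball_of_analyticOnNhd {φ : ℂ → ℂ} {M : ℝ}
    (hφ : AnalyticOnNhd ℂ φ (Metric.closedBall 0 M)) (hM : 0 ≤ M) :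
    ∃ R, M < R ∧ DifferentiableOn ℂ φ (Metric.ball 0 R) := by
  obtain ⟨δ, hδ, h⟩ := (isCompact_closedBall (0 : ℂ) M).exists_thickening_subset_open
    (isOpen_analyticAt ℂ φ) hφ
  rw [thickening_closedBall hδ hM] at h
  exact ⟨δ + M, by linarith, fun z hz => (h hz).differentiableAt.differentiableWithinAt⟩

/-- The Taylor series of `φ(z) / z`. -/
theorem taylor_of_analyticOnNhd {φ : ℂ → ℂ} {M : ℝ} (h0 : φ 0 = 0) (hM : 0 ≤ M)
    (hφ : AnalyticOnNhd ℂ φ (Metric.closedBall 0 M)) :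
    (Summable fun k : ℕ => ‖iteratedDeriv (k + 1) φ 0 / (k + 1).factorial‖ * M ^ k) ∧
      ∀ z ∈ segm M, HasSum (fun k : ℕ => iteratedDeriv (k + 1) φ 0 / (k + 1).factorial * z ^ k)
        (dslope φ 0 z) := by
  obtain ⟨R, hR, hd⟩ := exists_differentiableOn_ball_of_analyticOnNhd hφ hM
  have hs : ∀ z ∈ Metric.ball (0 : ℂ) R, HasSum
      (fun k : ℕ => iteratedDeriv (k + 1) φ 0 / (k + 1).factorial * z ^ (k + 1)) (φ z) := by
    intro z hz
    have h := Complex.hasSum_taylorSeries_on_ball hd hz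
    rw [← hasSum_nat_add_iff' 1] at h
    simp only [Finset.sum_range_one, Nat.factorial_zero, iteratedDeriv_zero, h0, smul_zero,
      sub_zero] at h
    have e : ∀ k : ℕ, ((k + 1).factorial : ℂ)⁻¹ • z ^ (k + 1) • iteratedDeriv (k + 1) φ 0
        = iteratedDeriv (k + 1) φ 0 / (k + 1).factorial * z ^ (k + 1) := fun k => by
      rw [smul_eq_mul, smul_eq_mul]
      ring
    simp only [e] at h
    exact h
  have hs' : ∀ z ∈ Metric.ball (0 : ℂ) R, z ≠ 0 → HasSum
      (fun k : ℕ => iteratedDeriv (k + 1) φ 0 / (k + 1).factorial * z ^ k) (dslope φ 0 z) := by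
    intro z hz hz0
    have h := (hs z hz).mul_right z⁻¹
    rw [eq_mul_dslope h0 z, mul_comm z, mul_inv_cancel_right₀ hz0] at h
    simpa only [pow_succ, ← mul_assoc, mul_inv_cancel_right₀ hz0] using h
  constructor
  -- The power series converges absolutely at a point `r > M`, hence at `M`.
  · obtain ⟨r, hMr, hrR⟩ := exists_between hR
    have hr : 0 < r := hM.trans_lt hMr
    have h := (hs' (r : ℂ) (by simpa [abs_of_pos hr] using hrR)
      (by exact_mod_cast hr.ne')).summable.norm
    refine h.of_nonneg_of_le (fun k => by positivity) fun k => ?_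
    rw [norm_mul, norm_pow, Complex.norm_real, Real.norm_of_nonneg hr.le]
    gcongr
  · rintro _ ⟨x, ⟨hx0, hxM⟩, rfl⟩
    rcases hx0.eq_or_lt with rfl | hx
    · have := hasSum_single (f := fun k : ℕ =>
        iteratedDeriv (k + 1) φ 0 / (k + 1).factorial * (0 : ℂ) ^ k) 0 fun k hk => by simp [hk]
      simpa [dslope_same, iteratedDeriv_one] using this
    · exact hs' x (by simpa [abs_of_pos hx] using hxM.trans_lt hR) (by exact_mod_cast hx.ne')

end Taylor

end CovAn

theorem theorem2 {p m : ℕ} (f : CovAn.ImpulseResponse p m) (hf : CovAn.SqIntegrable f)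
    (hinf : CovAn.hInfNorm f hf ≠ ⊤) (φ : ℂ → ℂ)
    (hφ : AnalyticOnNhd ℂ φ
      ((fun x : ℝ => (x : ℂ)) '' Set.Icc 0 ((CovAn.hInfNorm f hf).toReal ^ 2)))
    (hφ0 : φ 0 = 0) :
    (∀ T : ℝ, 0 < T → CovAn.IsTraceClass (cfc φ (CovAn.covOperator f hf T))) ∧
    MeasureTheory.Integrable (CovAn.traceSpectral f hf φ) MeasureTheory.volume ∧
    Filter.Tendsto (fun T : ℝ => (1 / T : ℂ) * CovAn.opTrace (cfc φ (CovAn.covOperator f hf T)))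
      Filter.atTop (nhds (CovAn.covAnalyticCost f hf φ)) ∧
    (AnalyticOnNhd ℂ φ (Metric.closedBall 0 ((CovAn.hInfNorm f hf).toReal ^ 2)) →
      ∀ T : ℝ, 0 < T →
        HasSum (fun k : ℕ => iteratedDeriv (k + 1) φ 0 / (k + 1).factorial *
            CovAn.opTrace (CovAn.covOperator f hf T ^ (k + 1)))
          (CovAn.opTrace (cfc φ (CovAn.covOperator f hf T)))) := by
  have hS := CovAn.isSymbol_densitySymbol hf hinf
  set M : NNReal := (CovAn.hInfNorm f hf).toNNReal ^ 2 with hMdef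
  have hM : (CovAn.hInfNorm f hf).toReal ^ 2 = (M : ℝ) := by
    rw [hMdef, NNReal.coe_pow]
    rfl
  rw [hM] at hφ ⊢
  have hK : ∀ T : ℝ, 0 < T →
      CovAn.IsToeplitz T (CovAn.densitySymbol hf) (CovAn.covOperator f hf T) :=
    fun T _ => CovAn.isToeplitz_covOperator hf
  have hg : ContinuousOn (dslope φ 0) (CovAn.segm M) :=
    CovAn.continuousOn_dslope_of_analyticOnNhd hφ
  have hmul : ∀ z ∈ CovAn.segm M, φ z = z * dslope φ 0 z := fun z _ =>
    CovAn.eq_mul_dslope hφ0 z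
  refine ⟨fun T hT => ((hK T hT).hasPowerTraces hT.le hS).isTraceClass_cfc ((hK T hT).nonneg hS)
      ((hK T hT).norm_le hS) hg hmul,
    CovAn.integrable_traceSpectral hf hS hφ.continuousOn hg hmul, ?_, fun hball T hT => ?_⟩
  · rw [CovAn.covAnalyticCost_eq hf hS hφ.continuousOn]
    exact CovAn.tendsto_opTrace_cfc hS hK hg hmul
  · obtain ⟨ha, hag⟩ := CovAn.taylor_of_analyticOnNhd hφ0 M.2 hball
    have ht := (hK T hT).hasPowerTraces hT.le hS
    simp only [ht.opTrace_pow]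
    exact ht.hasSum_taylor ((hK T hT).nonneg hS) ((hK T hT).norm_le hS) hg hmul ha hag

end
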